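/- All graphs are finite and simple; $\delta(G)$ is the minimum degree and $\alpha(G)$ the independence number of $G$. Let $k\ge 2$ be an integer. The family $\mathcal T(2k+1)$ is defined as follows. For a tree $R$ let $\mathrm{Leaf}(R)$ be its set of leaves (vertices of degree $1$), and for $x\in V(R)\setminus \mathrm{Leaf}(R)$ let $d'(x)$ be the degree of $x$ in $R-\mathrm{Leaf}(R)$ and $\ell(x)$ the number of leaves adjacent to $x$ in $R$. Suppose that every $x\in V(R)\setminus\mathrm{Leaf}(R)$ satisfies $d'(x)\in\{1,3,\dots,2k+1\}$ and $2\ell(x)+d'(x)\le 2k+1$. Let $T_R$ be the tree obtained from $R$ by inserting a new vertex of degree $2$ into each edge of $R-\mathrm{Leaf}(R)$, and by adding $k-r-\ell(x)$ new pendant edges at every $x\in V(R)\setminus\mathrm{Leaf}(R)$ with $d'(x)=2r+1<2k+1$. Then $\mathcal T(2k+1)$ is the set of all trees $T_R$ for such $R$. A $\{K_{1,1},\dots,K_{1,k},\mathcal T(2k+1)\}$-factor of $G$ is a spanning subgraph of $G$ each of whose connected components is isomorphic to one of the stars $K_{1,1},\dots,K_{1,k}$ or to a member of $\mathcal T(2k+1)$.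 **Theorem.** (i) If a graph $G$ satisfies $$\delta(G)\ \ge\ \frac{2\alpha(G)}{2k+1},$$ then $G$ has a $\{K_{1,1},\dots,K_{1,k},\mathcal T(2k+1)\}$-factor. (ii) The bound is essentially sharp, in that it cannot be replaced by $\delta(G)\ge\frac{\alpha(G)-1}{k+1/2}$: for every integer $t\ge 0$, the graph $G=K_{2+2t}\vee\big((1+t)(2k+1)+1\big)K_1$ (the join of a complete graph on $2+2t$ vertices and $(1+t)(2k+1)+1$ isolated vertices) satisfies $\delta(G)=2+2t$, $\alpha(G)=(1+t)(2k+1)+1$ and hence $\delta(G)=\frac{\alpha(G)-1}{k+1/2}$, but it has no $\{K_{1,1},\dots,K_{1,k},\mathcal T(2k+1)\}$-factor. -/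

import Mathlib

namespace ComponentFactor

universe u

open SimpleGraph

variable {W : Type u}

/-- The leaves of `R`: the vertices of degree one. -/
def leaves (R : SimpleGraph W) : Set W :=
  {x | (R.neighborSet x).ncard = 1}

/-- The graph `R - Leaf(R)`. -/
def core (R : SimpleGraph W) : SimpleGraph ↥(leaves R)ᶜ :=
  R.induce (leaves R)ᶜ

/-- The degree of `x` in `R - Leaf(R)`. -/
noncomputable def coreDegree (R : SimpleGraph W) (x : ↥(leaves R)ᶜ) : ℕ :=
  ((core R).neighborSet x).ncard

/-- The number of leaves of `R` that are adjacent to `x` in `R`. -/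
noncomputable def leafCount (R : SimpleGraph W) (x : ↥(leaves R)ᶜ) : ℕ :=
  {y | y ∈ leaves R ∧ R.Adj x y}.ncard

/-- The trees `R` from which the members of `𝒯(2k+1)` are built: every non-leaf `x` has odd degree
at most `2k+1` in `R - Leaf(R)`, and twice the number of leaves at `x` plus this degree is at
most `2k+1`. -/
structure IsBaseTree (k : ℕ) (R : SimpleGraph W) : Prop where
  isTree : R.IsTree
  coreDegree_odd : ∀ x : ↥(leaves R)ᶜ, ∃ r ≤ k, coreDegree R x = 2 * r + 1
  leafCount_le : ∀ x : ↥(leaves R)ᶜ, 2 * leafCount R x + coreDegree R x ≤ 2 * k + 1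

/-- The number of new pendant edges at `x`. If the degree of `x` in `R - Leaf(R)` is `2r+1`, then
`coreDegree R x / 2 = r`. For a base tree neither subtraction truncates, and the value
is `0` if `r = k`. -/
noncomputable def pendantCount (k : ℕ) (R : SimpleGraph W) (x : ↥(leaves R)ᶜ) : ℕ :=
  k - coreDegree R x / 2 - leafCount R x

/-- The vertices of `T_R`: those of `R`, one for each edge of `R - Leaf(R)`, and the ends of the new
pendant edges. -/
inductive TreeVertex (k : ℕ) (R : SimpleGraph W) : Type u
  | old (v : W)
  | mid (e : ↥(core R).edgeSet)
  | pendant (x : ↥(leaves R)ᶜ) (i : Fin (pendantCount k R x))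

/-- One orientation of the adjacency of `T_R`: the edges of `R` at a leaf are kept, the vertex
inserted into an edge of `R - Leaf(R)` is joined to the two ends of this edge, and the
new pendant vertices at `x` are joined to `x`. -/
def treeRel (k : ℕ) (R : SimpleGraph W) : TreeVertex k R → TreeVertex k R → Prop
  | .old u, .old v => R.Adj u v ∧ (u ∈ leaves R ∨ v ∈ leaves R)
  | .old u, .mid e => ∃ h : u ∈ (leaves R)ᶜ, (⟨u, h⟩ : ↥(leaves R)ᶜ) ∈ (e : Sym2 ↥(leaves R)ᶜ)
  | .old u, .pendant x _ => u = x
  | _, _ => False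

/-- The graph `T_R`. -/
def treeOf (k : ℕ) (R : SimpleGraph W) : SimpleGraph (TreeVertex k R) :=
  SimpleGraph.fromRel (treeRel k R)

/-- `T` is isomorphic to a member of the family `𝒯(2k+1)`. -/
def IsSpecialTree (k : ℕ) (T : SimpleGraph W) : Prop :=
  ∃ (m : ℕ) (R : SimpleGraph (Fin m)), IsBaseTree k R ∧ Nonempty (T ≃g treeOf k R)

/-- `T` is isomorphic to one of the stars `K_{1,1}, …, K_{1,k}`. -/
def IsSmallStar (k : ℕ) (T : SimpleGraph W) : Prop :=
  ∃ j : ℕ, 1 ≤ j ∧ j ≤ k ∧ Nonempty (T ≃g completeBipartiteGraph (Fin 1) (Fin j))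

/-- `G` has a `{K_{1,1}, …, K_{1,k}, 𝒯(2k+1)}`-factor: a spanning subgraph `H`, each of whose
connected components is isomorphic to a member of this family. -/
def HasStarTreeFactor (k : ℕ) (G : SimpleGraph W) : Prop :=
  ∃ H : SimpleGraph W, H ≤ G ∧
    ∀ c : H.ConnectedComponent, IsSmallStar k c.toSimpleGraph ∨ IsSpecialTree k c.toSimpleGraph

/-- The join of two vertex-disjoint graphs. -/
def join {V : Type*} {W : Type*} (G : SimpleGraph V) (H : SimpleGraph W) : SimpleGraph (V ⊕ W) :=
  (G ⊕g H) ⊔ completeBipartiteGraph V W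

/-- The graph `K_{2+2t} ∨ ((1+t)(2k+1)+1) K_1`. -/
def extremalGraph (k t : ℕ) :
    SimpleGraph (Fin (2 + 2 * t) ⊕ Fin ((1 + t) * (2 * k + 1) + 1)) :=
  join (⊤ : SimpleGraph (Fin (2 + 2 * t)))
    (⊥ : SimpleGraph (Fin ((1 + t) * (2 * k + 1) + 1)))

end ComponentFactor

/-! (i) The degree condition is used only through its consequence 2|S| ≤ (2k+1)|N(S)| for all
independent S. Take an independent set I that maximizes |I| - |N(I)|, and put A = N(I). Maximality
gives Hall's condition from A into I, and also gives every subset of the rest Q at least as many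
neighbors inside Q (`card_le_inter`, `card_le_rest`). Hence Q is covered by stars with at most two
leaves (`exists_star_cover`).

On I ∪ A, every vertex of I sends two tokens to neighbors in A so that every vertex of A receives
between 1 and 2k+1 of them. Keep the pairs along which tokens travel, and choose the distribution
with the fewest split senders, those whose tokens go to different receivers. If a split sender has
an unsaturated receiver, minimality forces load 1 at both of its receivers, and its component is
K_{1,2}. An unsaturated receiver without split senders is the center of a star with at most k
leaves. In the remaining components every receiver has load 2k+1. There the split senders are the
inserted vertices of degree 2 and the other senders are leaves; minimality also excludes cycles
(`IsMinTokenPair.card_lt`), so the component lies in 𝒯(2k+1) (`IsBranching.isSpecialTree`).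

(ii) Let every vertex of a factor distribute weight 2 equally among its neighbors. Then no vertex
receives more than 2k+1, so 2|S| ≤ (2k+1)|V \ S| for independent S (`two_mul_card_le_of_isLight`).
The large independent side of the extremal graph violates this. -/

namespace ComponentFactor

/-! ### Token distributions with few split senders. -/

section Tokens

open Finset

variable {α β : Type*} [Fintype α] [DecidableEq β]

/-- The number of tokens that `b` receives if every `x` sends one token to `f x` and one to
`g x`. -/
def load (f g : α → β) (b : β) : ℕ := #{x | f x = b} + #{x | g x = b}

/-- Every `x` sends two tokens along the relation `t`, and every vertex on the other side receives
at least one and at most `m` tokens. -/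
structure IsTokenPair (t : α → Finset β) (m : ℕ) (f g : α → β) : Prop where
  left_mem : ∀ x, f x ∈ t x
  right_mem : ∀ x, g x ∈ t x
  pos : ∀ b, 1 ≤ load f g b
  le : ∀ b, load f g b ≤ m

theorem load_comm (f g : α → β) (b : β) : load f g b = load g f b := Nat.add_comm _ _

theorem IsTokenPair.symm {t : α → Finset β} {m : ℕ} {f g : α → β} (h : IsTokenPair t m f g) :
    IsTokenPair t m g f where
  left_mem := h.right_mem
  right_mem := h.left_mem
  pos b := load_comm f g b ▸ h.pos b
  le b := load_comm f g b ▸ h.le b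

theorem card_filter_update [DecidableEq α] (f : α → β) (x : α) (b c : β) :
    #{y | Function.update f x b y = c} + (if f x = c then 1 else 0) =
      #{y | f y = c} + (if b = c then 1 else 0) := by
  simp only [card_filter]
  rw [Fintype.sum_eq_add_sum_compl x,
    Fintype.sum_eq_add_sum_compl x (fun y => if f y = c then 1 else 0)]
  have : ∑ i ∈ ({x} : Finset α)ᶜ, (if Function.update f x b i = c then 1 else 0) =
      ∑ i ∈ ({x} : Finset α)ᶜ, (if f i = c then 1 else 0) := by
    refine sum_congr rfl fun i hi => ?_
    rw [Function.update_of_ne (by simpa using hi)]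
  rw [this, Function.update_self]
  ring

theorem load_eq (f g : α → β) (b : β) :
    load f g b = 2 * #{x | f x = b ∧ g x = b} + #{x | f x ≠ g x ∧ (f x = b ∨ g x = b)} := by
  unfold load
  simp only [card_filter, mul_sum, ← sum_add_distrib]
  refine sum_congr rfl fun x _ => ?_
  by_cases h1 : f x = b <;> by_cases h2 : g x = b <;> simp [h1, h2]
  · exact fun h => h2 h.symm

/-- A token pair with as few split senders as possible. -/
structure IsMinTokenPair (t : α → Finset β) (m : ℕ) (f g : α → β) : Prop
    extends IsTokenPair t m f g where
  min : ∀ f' g' : α → β, IsTokenPair t m f' g' → #{x | f x ≠ g x} ≤ #{x | f' x ≠ g' x}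

theorem IsMinTokenPair.symm {t : α → Finset β} {m : ℕ} {f g : α → β}
    (h : IsMinTokenPair t m f g) : IsMinTokenPair t m g f where
  toIsTokenPair := h.toIsTokenPair.symm
  min f' g' h' := by simpa only [ne_comm] using h.min f' g' h'

variable [DecidableEq α]

/-- Hall's theorem with supplies two and capacities `m`. -/
theorem exists_load_le (t : α → Finset β) (m : ℕ)
    (h : ∀ s : Finset α, 2 * #s ≤ m * #(s.biUnion t)) :
    ∃ f g : α → β, (∀ x, f x ∈ t x) ∧ (∀ x, g x ∈ t x) ∧ ∀ b, load f g b ≤ m := by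
  -- The tokens are the pairs in `α × Bool`; they are to be matched injectively into `m` slots at
  -- every receiver.
  have key : ∀ s : Finset (α × Bool),
      #s ≤ #(s.biUnion fun p => t p.1 ×ˢ (univ : Finset (Fin m))) := by
    intro s
    have h1 : (s.biUnion fun p => t p.1 ×ˢ (univ : Finset (Fin m))) =
        (s.image Prod.fst).biUnion t ×ˢ univ := by
      ext ⟨b, i⟩
      simp
    have h2 : #s ≤ 2 * #(s.image Prod.fst) := by
      calc #s ≤ #(s.image Prod.fst ×ˢ (univ : Finset Bool)) :=
            card_le_card fun p hp => by
              simp only [mem_product, mem_univ, and_true]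
              exact mem_image_of_mem _ hp
        _ = 2 * #(s.image Prod.fst) := by rw [card_product]; simp [mul_comm]
    rw [h1, card_product, card_univ, Fintype.card_fin]
    have := h (s.image Prod.fst)
    rw [mul_comm (card _)]
    omega
  obtain ⟨F, hF, hFt⟩ := (all_card_le_biUnion_card_iff_exists_injective _).1 key
  simp only [mem_product, mem_univ, and_true] at hFt
  refine ⟨fun x => (F (x, false)).1, fun x => (F (x, true)).1, fun x => hFt _, fun x => hFt _, ?_⟩
  intro b
  have h1 : ∀ i, #{x | (F (x, i)).1 = b} =
      #(image (fun x => (F (x, i)).2) {x | (F (x, i)).1 = b}) := by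
    intro i
    refine (card_image_of_injOn fun x hx y hy hxy => ?_).symm
    simp only [coe_filter, mem_univ, true_and, Set.mem_ofPred_eq] at hx hy
    have := hF (Prod.ext (hx.trans hy.symm) hxy)
    exact congrArg Prod.fst this
  unfold load
  rw [h1, h1, ← card_union_of_disjoint]
  · exact (card_le_univ _).trans (by simp)
  · rw [disjoint_left]
    intro i hi hj
    simp only [mem_image, mem_filter, mem_univ, true_and] at hi hj
    obtain ⟨x, hx, hx'⟩ := hi
    obtain ⟨y, hy, hy'⟩ := hj
    have := hF (Prod.ext (hx.trans hy.symm) (hx'.trans hy'.symm))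
    simpa using congrArg Prod.snd this

/-- Among the distributions with loads at most `m`, take one with the most `b` such that `f (e b) =
b`. If some `b` received nothing, redirecting the first token of `e b` to `b` would increase this
number: as `e` is injective, no other agreement is lost. -/
theorem exists_isTokenPair [Fintype β] (t : α → Finset β) {m : ℕ} (hm : 1 ≤ m)
    (h : ∀ s : Finset α, 2 * #s ≤ m * #(s.biUnion t))
    (e : β → α) (he : Function.Injective e) (het : ∀ b, b ∈ t (e b)) :
    ∃ f g : α → β, IsTokenPair t m f g := by
  obtain ⟨f₀, g₀, hf₀, hg₀, hl₀⟩ := exists_load_le t m h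
  obtain ⟨⟨f, g⟩, hfg, hmax⟩ := exists_max_image
    (univ.filter fun p : (α → β) × (α → β) =>
      (∀ x, p.1 x ∈ t x) ∧ (∀ x, p.2 x ∈ t x) ∧ ∀ b, load p.1 p.2 b ≤ m)
    (fun p => #{b | p.1 (e b) = b}) ⟨(f₀, g₀), by simp [*]⟩
  simp only [mem_filter, mem_univ, true_and, Prod.forall, and_imp] at hfg hmax
  obtain ⟨hf, hg, hl⟩ := hfg
  refine ⟨f, g, hf, hg, fun b => ?_, hl⟩
  by_contra hb
  have hb0 : load f g b = 0 := by omega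
  have hfb : ∀ x, f x ≠ b := by
    intro x hx
    have : 0 < #{x | f x = b} := card_pos.2 ⟨x, by simpa using hx⟩
    unfold load at hb0
    omega
  have := hmax (Function.update f (e b) b) g ?_ hg ?_
  · refine absurd this (not_le.2 (card_lt_card ?_))
    rw [ssubset_iff_of_subset]
    · exact ⟨b, by simp, by simpa using hfb _⟩
    · intro c hc
      simp only [mem_filter, mem_univ, true_and] at hc ⊢
      rw [Function.update_of_ne]
      · exact hc
      · rintro hcb
        have := he hcb
        subst this
        exact hfb _ hc
  · intro x
    rcases eq_or_ne x (e b) with rfl | hx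
    · simpa using het b
    · simpa [hx] using hf x
  · intro c
    have h1 := card_filter_update f (e b) b c
    have h2 := hl c
    unfold load at h2 hb0 ⊢
    rcases eq_or_ne b c with rfl | hc
    · simp [hfb] at h1
      omega
    · simp only [hc, if_false] at h1
      omega

theorem exists_isMinTokenPair [Fintype β] (t : α → Finset β) {m : ℕ} (hm : 1 ≤ m)
    (h : ∀ s : Finset α, 2 * #s ≤ m * #(s.biUnion t))
    (e : β → α) (he : Function.Injective e) (het : ∀ b, b ∈ t (e b)) :
    ∃ f g : α → β, IsMinTokenPair t m f g := by
  classical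
  obtain ⟨f₀, g₀, h₀⟩ := exists_isTokenPair t hm h e he het
  obtain ⟨⟨f, g⟩, hfg, hmin⟩ := exists_min_image
    (univ.filter fun p : (α → β) × (α → β) => IsTokenPair t m p.1 p.2)
    (fun p => #{x | p.1 x ≠ p.2 x}) ⟨(f₀, g₀), by simpa using h₀⟩
  simp only [mem_filter, mem_univ, true_and, Prod.forall] at hfg hmin
  exact ⟨f, g, hfg, hmin⟩

/-- If `g x` held another token, the second token of `x` could move to `f x`, which has room, and
`x` would no longer be split. -/
theorem IsMinTokenPair.load_right_eq_one {t : α → Finset β} {m : ℕ} {f g : α → β}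
    (h : IsMinTokenPair t m f g) {x : α} (hx : f x ≠ g x) (hl : load f g (f x) < m) :
    load f g (g x) = 1 := by
  by_contra hne
  have hg1 : 2 ≤ load f g (g x) := by have := h.pos (g x); omega
  have := h.min f (Function.update g x (f x)) ⟨h.left_mem, fun y => ?_, fun c => ?_, fun c => ?_⟩
  · refine absurd this (not_le.2 (card_lt_card ?_))
    rw [ssubset_iff_of_subset]
    · exact ⟨x, by simpa using hx, by simp⟩
    · intro y
      rcases eq_or_ne y x with rfl | hy
      · simp
      · simp [hy]
  · rcases eq_or_ne y x with rfl | hy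
    · simpa using h.left_mem y
    · simpa [hy] using h.right_mem y
  · have h1 := card_filter_update g x (f x) c
    have h2 := h.pos c
    unfold load at *
    rcases eq_or_ne (g x) c with rfl | hc
    · simp only [if_true, hx, if_false] at h1
      omega
    · simp only [hc, if_false] at h1
      omega
  · have h1 := card_filter_update g x (f x) c
    have h2 := h.le c
    unfold load at *
    rcases eq_or_ne (f x) c with rfl | hc
    · simp only [if_true, hx.symm, if_false] at h1
      omega
    · simp only [hc, if_false] at h1
      omega

theorem IsMinTokenPair.load_left_eq_one {t : α → Finset β} {m : ℕ} {f g : α → β}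
    (h : IsMinTokenPair t m f g) {x : α} (hx : f x ≠ g x) (hl : load f g (g x) < m) :
    load f g (f x) = 1 := by
  rw [load_comm] at hl ⊢
  exact h.symm.load_right_eq_one hx.symm hl

/-- The split senders of a minimal token pair form a forest. -/
theorem IsMinTokenPair.card_lt {t : α → Finset β} {m : ℕ} {f g : α → β}
    (h : IsMinTokenPair t m f g) {B : Finset α} (hB : B.Nonempty) (hfg : ∀ x ∈ B, f x ≠ g x) :
    #B < #(B.image f ∪ B.image g) := by
  by_contra hcon
  -- A smallest counterexample `C` behaves like a cycle: it has exactly as many receivers as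
  -- senders, and each of these receivers turns out to get two tokens from `C`.
  obtain ⟨C, hC, hmin⟩ := exists_min_image
    (univ.filter fun C : Finset α => C.Nonempty ∧ (∀ x ∈ C, f x ≠ g x) ∧
      #(C.image f ∪ C.image g) ≤ #C) card ⟨B, by simpa using ⟨hB, hfg, not_lt.1 hcon⟩⟩
  simp only [mem_filter, mem_univ, true_and, and_imp] at hC hmin
  clear hcon hfg hB
  obtain ⟨hne, hfg, hle⟩ := hC
  set N : Finset α → Finset β := fun D => D.image f ∪ D.image g with hN
  have hmono : ∀ {D E : Finset α}, D ⊆ E → N D ⊆ N E := fun hDE =>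
    union_subset_union (image_subset_image hDE) (image_subset_image hDE)
  have hlt : ∀ D ⊂ C, D.Nonempty → #D < #(N D) := by
    intro D hD hDne
    by_contra hcon
    exact absurd (hmin D hDne (fun x hx => hfg x (hD.subset hx)) (not_lt.1 hcon))
      (not_le.2 (card_lt_card hD))
  have hone : ∀ x ∈ C, (C.erase x).Nonempty := by
    intro x hx
    by_contra hcon
    rw [not_nonempty_iff_eq_empty] at hcon
    have hCx : C = {x} := by rw [← insert_erase hx, hcon]; rfl
    have : #(N C) = 2 := by
      rw [hN, hCx]
      simp only [image_singleton]
      exact card_pair (hfg x hx)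
    rw [hCx, card_singleton] at hle
    rw [hN, hCx] at this
    simp only at this
    omega
  have hCN : #C ≤ #(N C) := by
    obtain ⟨x, hx⟩ := hne
    have h1 := hlt _ (erase_ssubset hx) (hone x hx)
    have h2 := card_le_card (hmono (erase_subset x C))
    rw [card_erase_of_mem hx] at h1
    omega
  -- Hall's theorem yields a bijection `p` from `C` to its receivers that picks one of the two
  -- receivers of each sender: an orientation of the cycle.
  have hhall : ∀ s : Finset C, #s ≤ #(s.biUnion fun x => ({f x, g x} : Finset β)) := by
    intro s
    have h1 : (s.biUnion fun x => ({f x, g x} : Finset β)) = N (s.map (.subtype _)) := by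
      ext b
      simp only [mem_biUnion, mem_insert, mem_singleton, hN, mem_union, mem_image, mem_map,
        Function.Embedding.subtype_apply]
      constructor
      · rintro ⟨x, hx, rfl | rfl⟩
        · exact Or.inl ⟨x, ⟨x, hx, rfl⟩, rfl⟩
        · exact Or.inr ⟨x, ⟨x, hx, rfl⟩, rfl⟩
      · rintro (⟨_, ⟨x, hx, rfl⟩, rfl⟩ | ⟨_, ⟨x, hx, rfl⟩, rfl⟩)
        · exact ⟨x, hx, Or.inl rfl⟩
        · exact ⟨x, hx, Or.inr rfl⟩
    have h2 : s.map (.subtype _) ⊆ C := fun x hx => by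
      obtain ⟨y, _, rfl⟩ := mem_map.1 hx
      exact y.2
    rw [h1, ← card_map (.subtype (· ∈ C))]
    rcases s.eq_empty_or_nonempty with rfl | hs
    · simp
    rcases h2.eq_or_ssubset with h3 | h3
    · rw [h3]; exact hCN
    · exact (hlt _ h3 (by simpa using hs)).le
  obtain ⟨p, hp, hpm⟩ := (all_card_le_biUnion_card_iff_exists_injective _).1 hhall
  simp only [mem_insert, mem_singleton] at hpm
  have hpN : univ.image p = N C := by
    refine eq_of_subset_of_card_le ?_ ?_
    · intro b hb
      obtain ⟨x, -, rfl⟩ := mem_image.1 hb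
      simp only [hN, mem_union, mem_image]
      rcases hpm x with h1 | h1
      · exact Or.inl ⟨x, x.2, h1.symm⟩
      · exact Or.inr ⟨x, x.2, h1.symm⟩
    · rw [card_image_of_injective _ hp]
      simpa using hle
  -- A receiver with a single token from `C` would disappear together with its sender, leaving a
  -- smaller counterexample.
  have hd2 : ∀ b ∈ N C, 2 ≤ #{x ∈ C | f x = b} + #{x ∈ C | g x = b} := by
    intro b hb
    by_contra hcon
    obtain ⟨x, hx, hxb⟩ : ∃ x ∈ C, f x = b ∨ g x = b := by
      simp only [hN, mem_union, mem_image] at hb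
      rcases hb with ⟨x, h1, h2⟩ | ⟨x, h1, h2⟩
      exacts [⟨x, h1, Or.inl h2⟩, ⟨x, h1, Or.inr h2⟩]
    have hsub : N (C.erase x) ⊆ (N C).erase b := by
      intro c hc
      refine mem_erase.2 ⟨?_, hmono (erase_subset x C) hc⟩
      rintro rfl
      refine hcon ?_
      simp only [hN, mem_union, mem_image, mem_erase] at hc
      have two : ∀ (q : α → β) (y z : α), y ∈ C → z ∈ C → y ≠ z → q y = c → q z = c →
          2 ≤ #{x ∈ C | q x = c} := by
        intro q y z hy hz hyz h1 h2
        rw [← card_pair hyz]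
        refine card_le_card fun w hw => ?_
        rcases mem_insert.1 hw with rfl | hw
        · simp [*]
        · rw [mem_singleton.1 hw]; simp [*]
      have one : ∀ (q : α → β) (y : α), y ∈ C → q y = c → 1 ≤ #{x ∈ C | q x = c} :=
        fun q y hy h1 => card_pos.2 ⟨y, by simp [*]⟩
      rcases hc with ⟨y, ⟨hyx, hyC⟩, hy⟩ | ⟨y, ⟨hyx, hyC⟩, hy⟩ <;> rcases hxb with hxb | hxb
      · have := two f y x hyC hx hyx hy hxb; omega
      · have h1 := one f y hyC hy
        have h2 := one g x hx hxb
        omega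
      · have h1 := one g y hyC hy
        have h2 := one f x hx hxb
        omega
      · have := two g y x hyC hx hyx hy hxb; omega
    have h1 := card_le_card hsub
    rw [card_erase_of_mem hb] at h1
    have h2 := hlt _ (erase_ssubset hx) (hone x hx)
    rw [card_erase_of_mem hx] at h2
    have h3 : #(N C) ≤ #C := hle
    omega
  have hsum : ∑ b ∈ N C, (#{x ∈ C | f x = b} + #{x ∈ C | g x = b}) = ∑ _b ∈ N C, 2 := by
    rw [sum_add_distrib, ← card_eq_sum_card_fiberwise, ← card_eq_sum_card_fiberwise, sum_const]
    · simp only [smul_eq_mul]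
      have := hle
      have h2 := hCN
      simp only [hN] at h2 ⊢
      omega
    · exact fun x hx => by
        simp only [hN, coe_union, coe_image]
        exact Or.inr ⟨x, hx, rfl⟩
    · exact fun x hx => by
        simp only [hN, coe_union, coe_image]
        exact Or.inl ⟨x, hx, rfl⟩
  have hdeg : ∀ b ∈ N C, 2 = #{x ∈ C | f x = b} + #{x ∈ C | g x = b} :=
    (sum_eq_sum_iff_of_le hd2).1 hsum.symm
  have hdeg0 : ∀ b ∉ N C, #{x ∈ C | f x = b} = 0 ∧ #{x ∈ C | g x = b} = 0 := by
    intro b hb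
    simp only [hN, mem_union, mem_image, not_or, not_exists, not_and] at hb
    simp only [card_eq_zero, filter_eq_empty_iff]
    exact hb
  -- Every `x ∈ C` now sends both tokens to `p x`. Each receiver of `C` still gets exactly two
  -- tokens from `C`, so no load changes while the senders in `C` stop being split.
  set q : (α → β) → α → β := fun f x => if hx : x ∈ C then p ⟨x, hx⟩ else f x with hq
  have hqC : ∀ (f : α → β) x (hx : x ∈ C), q f x = p ⟨x, hx⟩ := fun f x hx => by simp [hq, hx]
  have hqC' : ∀ (f : α → β) x, x ∉ C → q f x = f x := fun f x hx => by simp [hq, hx]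
  have hpf : ∀ b ∈ N C, ∀ f : α → β, #{x ∈ C | q f x = b} = 1 := by
    intro b hb f
    rw [← hpN] at hb
    obtain ⟨⟨y, hy⟩, -, rfl⟩ := mem_image.1 hb
    rw [card_eq_one]
    refine ⟨y, ?_⟩
    ext x
    simp only [mem_filter, mem_singleton]
    constructor
    · rintro ⟨hx, hxy⟩
      rw [hqC _ _ hx] at hxy
      exact congrArg Subtype.val (hp hxy)
    · rintro rfl
      exact ⟨hy, hqC _ _ hy⟩
  have hpf0 : ∀ b ∉ N C, ∀ f : α → β, #{x ∈ C | q f x = b} = 0 := by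
    intro b hb f
    rw [← hpN] at hb
    simp only [card_eq_zero, filter_eq_empty_iff]
    intro x hx hxb
    rw [hqC _ _ hx] at hxb
    exact hb (mem_image.2 ⟨_, mem_univ _, hxb⟩)
  have hsplit : ∀ (f : α → β) b, #{x | f x = b} = #{x ∈ C | f x = b} + #{x ∈ Cᶜ | f x = b} := by
    intro f b
    rw [← card_union_of_disjoint, ← filter_union, union_compl]
    exact disjoint_filter_filter disjoint_compl_right
  have hout : ∀ (f : α → β) b, #{x ∈ Cᶜ | q f x = b} = #{x ∈ Cᶜ | f x = b} := by
    intro f b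
    congr 1
    refine filter_congr fun x hx => ?_
    rw [hqC' _ _ (by simpa using hx)]
  have hload : ∀ b, load (q f) (q g) b = load f g b := by
    intro b
    unfold load
    rw [hsplit, hsplit (q g), hsplit f, hsplit g, hout, hout]
    by_cases hb : b ∈ N C
    · have := hdeg b hb
      rw [hpf b hb, hpf b hb]
      omega
    · rw [hpf0 b hb, hpf0 b hb, (hdeg0 b hb).1, (hdeg0 b hb).2]
  have hmem : ∀ x (hx : x ∈ C), p ⟨x, hx⟩ ∈ t x := by
    intro x hx
    rcases hpm ⟨x, hx⟩ with h1 | h1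
    · rw [h1]; exact h.left_mem x
    · rw [h1]; exact h.right_mem x
  have := h.min (q f) (q g) ⟨fun x => ?_, fun x => ?_, fun b => hload b ▸ h.pos b,
    fun b => hload b ▸ h.le b⟩
  · refine absurd this (not_le.2 (card_lt_card ?_))
    rw [ssubset_iff_of_subset]
    · obtain ⟨x, hx⟩ := hne
      exact ⟨x, by simpa using hfg x hx, by simp [hqC _ _ hx]⟩
    · intro x
      by_cases hx : x ∈ C
      · simp [hqC _ _ hx]
      · simp [hqC' _ _ hx]
  · by_cases hx : x ∈ C
    · rw [hqC _ _ hx]; exact hmem x hx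
    · rw [hqC' _ _ hx]; exact h.left_mem x
  · by_cases hx : x ∈ C
    · rw [hqC _ _ hx]; exact hmem x hx
    · rw [hqC' _ _ hx]; exact h.right_mem x

end Tokens

end ComponentFactor

/-! ### Star components and covers by small stars. -/

namespace ComponentFactor
open SimpleGraph

/-- `z` is the center of a component of `H` that is one of the stars `K_{1,1}, …, K_{1,k}`. -/
structure IsStarCenter {V : Type*} (H : SimpleGraph V) (k : ℕ) (z : V) : Prop where
  one_le : 1 ≤ (H.neighborSet z).ncard
  le : (H.neighborSet z).ncard ≤ k
  eq_of_adj : ∀ v w, H.Adj z v → H.Adj v w → w = z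

theorem IsStarCenter.eq_or_adj {V : Type*} {H : SimpleGraph V} {k : ℕ} {z : V}
    (h : IsStarCenter H k z) {v : V} (hv : H.Reachable z v) : v = z ∨ H.Adj z v := by
  obtain ⟨p⟩ := hv
  suffices ∀ u w, H.Walk u w → (u = z ∨ H.Adj z u) → (w = z ∨ H.Adj z w) from
    this _ _ p (Or.inl rfl)
  intro u w p
  induction p with
  | nil => exact id
  | cons huv _ ih =>
    rintro (rfl | hu)
    · exact ih (Or.inr huv)
    · exact ih (Or.inl (h.eq_of_adj _ _ hu huv))

theorem IsStarCenter.isSmallStar {V : Type*} {H : SimpleGraph V} {k : ℕ} {z : V}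
    (h : IsStarCenter H k z) {c : H.ConnectedComponent} (hz : z ∈ c.supp) :
    IsSmallStar k c.toSimpleGraph := by
  set j := (H.neighborSet z).ncard with hj
  have hfin : (H.neighborSet z).Finite := Set.finite_of_ncard_pos h.one_le
  have := hfin.to_subtype
  let e : Fin j ≃ H.neighborSet z := (Finite.equivFinOfCardEq rfl).symm
  have hadj : ∀ i, H.Adj z (e i) := fun i => (e i).2
  have hmem : ∀ i, (e i : V) ∈ c.supp := fun i => by
    rw [ConnectedComponent.mem_supp_iff] at hz ⊢
    rw [← hz]
    exact (ConnectedComponent.connectedComponentMk_eq_of_adj (hadj i)).symm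
  let F : Fin 1 ⊕ Fin j → c := Sum.elim (fun _ => ⟨z, hz⟩) fun i => ⟨e i, hmem i⟩
  have hF : Function.Bijective F := by
    constructor
    · rintro (a | a) (b | b) hab
      · rw [Subsingleton.elim a b]
      · exact absurd (congrArg Subtype.val hab) (hadj b).ne
      · exact absurd (congrArg Subtype.val hab).symm (hadj a).ne
      · rw [e.injective (Subtype.ext (congrArg (fun x : c => (x : V)) hab))]
    · rintro ⟨v, hv⟩
      have hr : H.Reachable z v := ConnectedComponent.exact
        (((ConnectedComponent.mem_supp_iff _ _).1 hz).trans
          ((ConnectedComponent.mem_supp_iff _ _).1 hv).symm)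
      rcases h.eq_or_adj hr with rfl | hzv
      · exact ⟨Sum.inl 0, rfl⟩
      · refine ⟨Sum.inr (e.symm ⟨v, hzv⟩), Subtype.ext ?_⟩
        change ((e (e.symm ⟨v, hzv⟩) : H.neighborSet z) : V) = v
        rw [Equiv.apply_symm_apply]
  refine ⟨j, h.one_le, h.le, ⟨RelIso.symm ⟨Equiv.ofBijective F hF, ?_⟩⟩⟩
  rintro (a | a) (b | b)
  · simp [F, ConnectedComponent.toSimpleGraph]
  · simpa [F, ConnectedComponent.toSimpleGraph] using hadj b
  · simpa [F, ConnectedComponent.toSimpleGraph] using (hadj a).symm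
  · simp only [F, ConnectedComponent.toSimpleGraph, Equiv.ofBijective_apply, Sum.elim_inr,
      comap_adj, Function.Embedding.subtype_apply, completeBipartiteGraph_adj, Sum.isLeft_inr,
      Sum.isRight_inr, Bool.false_eq_true, false_and, and_false, or_self, iff_false]
    intro hab
    exact (hadj b).ne (h.eq_of_adj _ _ (hadj a) hab).symm

/-- By `hH` every edge has an end of degree one, so components are stars. If `v` is not a center, it
has a neighbor `u` with a further neighbor; then `u` is never the pendant end of its edges, hence a
center. -/
theorem exists_isStarCenter {V : Type*} {H : SimpleGraph V} {k : ℕ}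
    (hfin : ∀ v, (H.neighborSet v).Finite) (hk : ∀ v, (H.neighborSet v).ncard ≤ k)
    (hH : ∀ u v, H.Adj u v → (∀ w, H.Adj u w → w = v) ∨ ∀ w, H.Adj v w → w = u)
    {v w : V} (hvw : H.Adj v w) : ∃ z, IsStarCenter H k z ∧ (v = z ∨ H.Adj z v) := by
  have hpos : ∀ {a b}, H.Adj a b → 1 ≤ (H.neighborSet a).ncard := fun {a b} hab =>
    (Set.ncard_pos (hfin a)).2 ⟨b, hab⟩
  by_cases hv : ∀ u u', H.Adj v u → H.Adj u u' → u' = v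
  · exact ⟨v, ⟨hpos hvw, hk v, hv⟩, Or.inl rfl⟩
  · push Not at hv
    obtain ⟨u, u', hvu, huu', hne⟩ := hv
    refine ⟨u, ⟨hpos huu', hk u, fun x y hux hxy => ?_⟩, Or.inr hvu.symm⟩
    rcases hH _ _ hux with h1 | h1
    · exact absurd ((h1 _ huu').trans (h1 _ hvu.symm).symm) hne
    · exact h1 _ hxy

/-- A graph in which every set `s ⊆ Q` has at least `#s` neighbors in `Q` has vertex disjoint stars
`K_{1,1}` and `K_{1,2}` that cover exactly `Q`. -/
theorem exists_star_cover {V : Type*} [Fintype V] [DecidableEq V] (G : SimpleGraph V)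
    [DecidableRel G.Adj] (Q : Finset V)
    (hQ : ∀ s ⊆ Q, s.card ≤ (s.biUnion fun v => G.neighborFinset v ∩ Q).card) :
    ∃ H ≤ G, (∀ u v, H.Adj u v → u ∈ Q ∧ v ∈ Q) ∧
      ∀ v ∈ Q, ∃ z, IsStarCenter H 2 z ∧ (v = z ∨ H.Adj z v) := by
  have hhall : ∀ s : Finset Q,
      s.card ≤ (s.biUnion fun v : Q => G.neighborFinset v.1 ∩ Q).card := by
    intro s
    have h1 := hQ (s.map (.subtype _)) (Finset.map_subtype_subset s)
    rw [Finset.card_map] at h1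
    refine h1.trans (Finset.card_le_card ?_)
    intro w
    simp
  obtain ⟨σ, hσ, hσm⟩ := (Finset.all_card_le_biUnion_card_iff_exists_injective _).1 hhall
  simp only [Finset.mem_inter, mem_neighborFinset] at hσm
  -- The edges of `F` join each `q` to `σ q`. As `σ` is injective, a vertex has at most one such
  -- edge going out and one coming in.
  let F : SimpleGraph V :=
    { Adj := fun u v => ∃ q : Q, (u = q ∧ v = σ q) ∨ (v = q ∧ u = σ q)
      symm := ⟨fun u v ⟨q, hq⟩ => ⟨q, hq.symm⟩⟩
      loopless := ⟨fun u ⟨q, hq⟩ => by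
        rcases hq with ⟨h1, h2⟩ | ⟨h1, h2⟩ <;>
          exact G.irrefl ((h1.symm.trans h2) ▸ (hσm q).1)⟩ }
  have hFG : F ≤ G := by
    rintro u v ⟨q, ⟨rfl, rfl⟩ | ⟨rfl, rfl⟩⟩
    · exact (hσm q).1
    · exact (hσm q).1.symm
  have hFQ : ∀ u v, F.Adj u v → u ∈ Q ∧ v ∈ Q := by
    rintro u v ⟨q, ⟨rfl, rfl⟩ | ⟨rfl, rfl⟩⟩
    · exact ⟨q.2, (hσm q).2⟩
    · exact ⟨(hσm q).2, q.2⟩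
  have hF2 : ∀ v, (F.neighborSet v).ncard ≤ 2 := by
    intro v
    have : F.neighborSet v ⊆
        {w : V | ∃ q : Q, v = q ∧ w = σ q} ∪ {w : V | ∃ q : Q, w = q ∧ v = σ q} := by
      rintro w ⟨q, hq | hq⟩
      · exact Or.inl ⟨q, hq⟩
      · exact Or.inr ⟨q, hq⟩
    refine (Set.ncard_le_ncard this (Set.toFinite _)).trans ((Set.ncard_union_le _ _).trans ?_)
    have h1 : {w : V | ∃ q : Q, v = q ∧ w = σ q}.ncard ≤ 1 := by
      refine (Set.ncard_le_one_iff (Set.toFinite _)).2 ?_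
      rintro a b ⟨q, hq, rfl⟩ ⟨q', hq', rfl⟩
      rw [Subtype.ext (hq.symm.trans hq')]
    have h2 : {w : V | ∃ q : Q, w = q ∧ v = σ q}.ncard ≤ 1 := by
      refine (Set.ncard_le_one_iff (Set.toFinite _)).2 ?_
      rintro a b ⟨q, rfl, hq⟩ ⟨q', rfl, hq'⟩
      rw [hσ (hq.symm.trans hq')]
    omega
  -- In a minimal subgraph without isolated vertices in `Q`, an edge with no end of degree one could
  -- be deleted.
  obtain ⟨H, hHP, hHmin⟩ := Set.Finite.exists_minimal
    (Set.toFinite {H : SimpleGraph V | H ≤ F ∧ ∀ v ∈ Q, ∃ w, H.Adj v w})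
    ⟨F, le_rfl, fun v hv => ⟨σ ⟨v, hv⟩, ⟨v, hv⟩, Or.inl ⟨rfl, rfl⟩⟩⟩
  obtain ⟨hHF, hHQ⟩ := hHP
  refine ⟨H, hHF.trans hFG, fun u v h => hFQ u v (hHF h), fun v hv => ?_⟩
  obtain ⟨w, hw⟩ := hHQ v hv
  refine exists_isStarCenter (fun _ => Set.toFinite _)
    (fun v => (Set.ncard_le_ncard (fun w h => hHF h) (Set.toFinite _)).trans (hF2 v))
    (fun a b hab => ?_) hw
  by_contra hcon
  push Not at hcon
  obtain ⟨⟨a', ha', hne⟩, b', hb', hne'⟩ := hcon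
  have hle : H.deleteEdges {s(a, b)} ≤ H := deleteEdges_le _
  have := hHmin ⟨hle.trans hHF, fun x hx => ?_⟩ hle hab
  · simp at this
  · simp only [deleteEdges_adj, Set.mem_singleton_iff]
    by_cases hxa : x = a
    · subst hxa
      refine ⟨a', ha', ?_⟩
      simp only [Sym2.eq_iff, true_and, not_or, not_and]
      exact ⟨hne, fun h => absurd (h ▸ hab) H.irrefl⟩
    by_cases hxb : x = b
    · subst hxb
      refine ⟨b', hb', ?_⟩
      simp only [Sym2.eq_iff, true_and, not_or, not_and]
      exact ⟨fun h => absurd (h ▸ hab) H.irrefl, hne'⟩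
    obtain ⟨y, hy⟩ := hHQ x hx
    exact ⟨y, hy, by simp [hxa, hxb]⟩

end ComponentFactor

/-! ### Recognizing the members of 𝒯(2k+1). -/

namespace ComponentFactor
open SimpleGraph

/-- A description of the members of `𝒯(2k+1)` by the set `A` of their branch vertices and the set
`M` of their vertices of degree two. -/
structure IsBranching {C : Type*} (k : ℕ) (T : SimpleGraph C) (A M : Set C) : Prop where
  connected : T.Connected
  notMem : ∀ b ∈ M, b ∉ A
  adj : ∀ u v, T.Adj u v → (u ∈ A ↔ v ∉ A)
  leaf : ∀ u, u ∉ A → u ∉ M → ∃ a, ∀ v, T.Adj u v ↔ v = a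
  mid : ∀ b ∈ M, ∃ a a', a ≠ a' ∧ ∀ v, T.Adj b v ↔ v = a ∨ v = a'
  eq_of_adj : ∀ b ∈ M, ∀ b' ∈ M, (∀ v, T.Adj b v → T.Adj b' v) → b = b'
  -- Equality means that the base tree already carries all the leaves and needs no new pendant
  -- edges.
  degree : ∀ a ∈ A, 2 * {u | u ∉ A ∧ u ∉ M ∧ T.Adj a u}.ncard + {b | b ∈ M ∧ T.Adj a b}.ncard =
    2 * k + 1
  -- Together with connectedness, this count replaces acyclicity.
  card_lt : M.ncard < A.ncard

/-- The tree obtained by suppressing the vertices in `M`; `ι` enumerates the other vertices. -/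
def suppress {C : Type*} (T : SimpleGraph C) (M : Set C) {m : ℕ} (ι : Fin m → C) :
    SimpleGraph (Fin m) where
  Adj i j := T.Adj (ι i) (ι j) ∨ (i ≠ j ∧ ∃ b ∈ M, T.Adj b (ι i) ∧ T.Adj b (ι j))
  symm := ⟨fun _ _ h => h.imp (fun h => h.symm)
    fun ⟨hne, b, hb, h1, h2⟩ => ⟨hne.symm, b, hb, h2, h1⟩⟩
  loopless := ⟨fun _ h => h.elim (fun h => T.irrefl h) fun h => h.1 rfl⟩

namespace IsBranching

variable {C : Type*} {k : ℕ} {T : SimpleGraph C} {A M : Set C} {m : ℕ} {ι : Fin m → C}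

theorem mem_of_adj_mid (h : IsBranching k T A M) {b v : C} (hb : b ∈ M) (hbv : T.Adj b v) :
    v ∈ A := by
  by_contra hv
  exact h.notMem b hb ((h.adj _ _ hbv).2 hv)

theorem exists_index (h : IsBranching k T A M) (hιr : ∀ u, u ∉ M → ∃ i, ι i = u) {a : C}
    (ha : a ∈ A) : ∃ i, ι i = a :=
  hιr a fun hM => h.notMem a hM ha

theorem suppress_adj_leaf (h : IsBranching k T A M) {i j : Fin m} (hi : ι i ∉ A) :
    (suppress T M ι).Adj i j ↔ T.Adj (ι i) (ι j) := by
  refine ⟨?_, Or.inl⟩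
  rintro (h1 | ⟨-, b, hb, h1, -⟩)
  · exact h1
  · exact absurd (h.mem_of_adj_mid hb h1) hi

theorem suppress_adj_core (h : IsBranching k T A M) {i j : Fin m} (hi : ι i ∈ A) (hj : ι j ∈ A) :
    (suppress T M ι).Adj i j ↔ i ≠ j ∧ ∃ b ∈ M, T.Adj b (ι i) ∧ T.Adj b (ι j) := by
  refine ⟨?_, Or.inr⟩
  rintro (h1 | h1)
  · exact absurd hj ((h.adj _ _ h1).1 hi)
  · exact h1

theorem mid_adj_iff (h : IsBranching k T A M) {b a a' v : C} (hb : b ∈ M) (hne : a ≠ a')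
    (h1 : T.Adj b a) (h2 : T.Adj b a') : T.Adj b v ↔ v = a ∨ v = a' := by
  obtain ⟨x, y, hxy, hv⟩ := h.mid b hb
  have h1' := (hv _).1 h1
  have h2' := (hv _).1 h2
  rw [hv]
  rcases h1' with rfl | rfl <;> rcases h2' with rfl | rfl
  · exact absurd rfl hne
  · rfl
  · exact or_comm
  · exact absurd rfl hne

theorem exists_other (h : IsBranching k T A M) {b a : C} (hb : b ∈ M) (hba : T.Adj b a) :
    ∃ a', a ≠ a' ∧ ∀ v, T.Adj b v ↔ v = a ∨ v = a' := by
  obtain ⟨x, y, hxy, hv⟩ := h.mid b hb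
  rcases (hv _).1 hba with rfl | rfl
  · exact ⟨y, hxy, hv⟩
  · exact ⟨x, hxy.symm, fun v => (hv v).trans or_comm⟩

theorem ncard_leaf_nbrs (h : IsBranching k T A M) (hι : Function.Injective ι)
    (hιM : ∀ i, ι i ∉ M) (hιr : ∀ u, u ∉ M → ∃ i, ι i = u) {i : Fin m} :
    {j | ι j ∉ A ∧ (suppress T M ι).Adj i j}.ncard =
      {u | u ∉ A ∧ u ∉ M ∧ T.Adj (ι i) u}.ncard := by
  refine Set.ncard_congr (fun j _ => ι j) ?_ (fun _ _ _ _ hab => hι hab) ?_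
  · rintro j ⟨hj, hij⟩
    exact ⟨hj, hιM j, ((h.suppress_adj_leaf hj).1 hij.symm).symm⟩
  · rintro u ⟨huA, huM, hu⟩
    obtain ⟨j, rfl⟩ := hιr u huM
    exact ⟨j, ⟨huA, Or.inl hu⟩, rfl⟩

/-- Each vertex of `M` at `ι i` leads to one other branch vertex; different ones lead to different
branch vertices by `eq_of_adj`. -/
theorem ncard_core_nbrs (h : IsBranching k T A M) (hι : Function.Injective ι)
    (hιr : ∀ u, u ∉ M → ∃ i, ι i = u) {i : Fin m} (hi : ι i ∈ A) :
    {j | ι j ∈ A ∧ (suppress T M ι).Adj i j}.ncard = {b | b ∈ M ∧ T.Adj (ι i) b}.ncard := by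
  have H : ∀ b ∈ {b | b ∈ M ∧ T.Adj (ι i) b},
      ∃ j, i ≠ j ∧ ∀ v, T.Adj b v ↔ v = ι i ∨ v = ι j := by
    rintro b ⟨hb, hib⟩
    obtain ⟨a', hne, hv⟩ := h.exists_other hb hib.symm
    obtain ⟨j, rfl⟩ := h.exists_index hιr (h.mem_of_adj_mid hb ((hv a').2 (Or.inr rfl)))
    exact ⟨j, fun hij => hne (congrArg ι hij), hv⟩
  choose o ho1 ho2 using H
  symm
  refine Set.ncard_congr o ?_ ?_ ?_
  · intro b hb
    have hbo := (ho2 b hb _).2 (Or.inr rfl)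
    exact ⟨h.mem_of_adj_mid hb.1 hbo, Or.inr ⟨ho1 b hb, b, hb.1, hb.2.symm, hbo⟩⟩
  · intro b b' hb hb' hbb
    refine h.eq_of_adj b hb.1 b' hb'.1 fun v hv => ?_
    rw [ho2 b hb, hbb] at hv
    rwa [ho2 b' hb']
  · rintro j ⟨hj, hij⟩
    obtain ⟨hne, b, hb, h1, h2⟩ := (h.suppress_adj_core hi hj).1 hij
    refine ⟨b, ⟨hb, h1.symm⟩, ?_⟩
    rcases (ho2 b ⟨hb, h1.symm⟩ _).1 h2 with h3 | h3
    · exact absurd (hι h3).symm hne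
    · exact (hι h3).symm

/-- A branch vertex with ℓ leaf neighbors and d core neighbors satisfies 2ℓ + d = 2k+1 > 2, so ℓ + d
= 1 is impossible. -/
theorem mem_leaves_iff (h : IsBranching k T A M) (hk : 2 ≤ k) (hι : Function.Injective ι)
    (hιM : ∀ i, ι i ∉ M) (hιr : ∀ u, u ∉ M → ∃ i, ι i = u) (i : Fin m) :
    i ∈ leaves (suppress T M ι) ↔ ι i ∉ A := by
  constructor
  · intro hi hiA
    have h1 := h.ncard_leaf_nbrs hι hιM hιr (i := i)
    have h2 := h.ncard_core_nbrs hι hιr hiA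
    have h3 := h.degree _ hiA
    have h4 : (suppress T M ι).neighborSet i =
        {j | ι j ∉ A ∧ (suppress T M ι).Adj i j} ∪ {j | ι j ∈ A ∧ (suppress T M ι).Adj i j} := by
      ext j
      by_cases hj : ι j ∈ A <;> simp [hj]
    have h5 : Disjoint {j | ι j ∉ A ∧ (suppress T M ι).Adj i j}
        {j | ι j ∈ A ∧ (suppress T M ι).Adj i j} :=
      Set.disjoint_left.2 fun j hj hj' => hj.1 hj'.1
    have h6 : ((suppress T M ι).neighborSet i).ncard = 1 := hi
    rw [h4, Set.ncard_union_eq h5 (Set.toFinite _) (Set.toFinite _)] at h6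
    omega
  · intro hi
    obtain ⟨a, ha⟩ := h.leaf _ hi (hιM i)
    have haA : a ∈ A := by
      by_contra hcon
      exact hi ((h.adj _ _ ((ha a).2 rfl)).2 hcon)
    obtain ⟨j, rfl⟩ := h.exists_index hιr haA
    refine Set.ncard_eq_one.2 ⟨j, ?_⟩
    ext j'
    rw [mem_neighborSet, h.suppress_adj_leaf hi, ha, hι.eq_iff, Set.mem_singleton_iff]

theorem isTree_suppress [Finite C] (h : IsBranching k T A M) (hι : Function.Injective ι)
    (hιM : ∀ i, ι i ∉ M) (hιr : ∀ u, u ∉ M → ∃ i, ι i = u) : (suppress T M ι).IsTree := by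
  classical
  have hend : ∀ u, ∃ i, (u ∉ M → ι i = u) ∧ (u ∈ M → T.Adj u (ι i)) := by
    intro u
    by_cases hu : u ∈ M
    · obtain ⟨a, a', -, hv⟩ := h.mid u hu
      have haA := h.mem_of_adj_mid hu ((hv a).2 (Or.inl rfl))
      obtain ⟨i, rfl⟩ := h.exists_index hιr haA
      exact ⟨i, fun hu' => absurd hu hu', fun _ => (hv _).2 (Or.inl rfl)⟩
    · obtain ⟨i, hi⟩ := hιr u hu
      exact ⟨i, fun _ => hi, fun hu' => absurd hu' hu⟩
  -- The map `ρ` sends a vertex of `M` to one of its two ends and fixes the other vertices up to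
  -- `ι`; it carries walks of `T` to connections in the suppressed graph.
  choose ρ hρ1 hρ2 using hend
  have hρι : ∀ i, ρ (ι i) = i := fun i => hι (hρ1 _ (hιM i))
  have hstep : ∀ u v, u ∈ A → T.Adj u v → (suppress T M ι).Reachable (ρ u) (ρ v) := by
    intro u v hu huv
    have hρu := hρ1 u fun hM => h.notMem u hM hu
    by_cases hv : v ∈ M
    · by_cases heq : ρ u = ρ v
      · rw [heq]
      · exact Adj.reachable (Or.inr ⟨heq, v, hv, by rw [hρu]; exact huv.symm, hρ2 v hv⟩)
    · exact Adj.reachable (Or.inl (by rw [hρu, hρ1 v hv]; exact huv))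
  have hstep' : ∀ u v, T.Adj u v → (suppress T M ι).Reachable (ρ u) (ρ v) := by
    intro u v huv
    by_cases hu : u ∈ A
    · exact hstep u v hu huv
    · refine (hstep v u ?_ huv.symm).symm
      by_contra hv
      exact hu ((h.adj _ _ huv).2 hv)
  have hwalk : ∀ u v, T.Walk u v → (suppress T M ι).Reachable (ρ u) (ρ v) := by
    intro u v p
    induction p with
    | nil => rfl
    | cons huv _ ih => exact (hstep' _ _ huv).trans ih
  have hconn : (suppress T M ι).Connected := by
    have : Nonempty (Fin m) := h.connected.nonempty.map ρ
    refine ⟨fun i j => ?_⟩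
    have := hwalk _ _ (h.connected.preconnected (ι i) (ι j)).some
    rwa [hρι, hρι] at this
  rw [isTree_iff_connected_and_card]
  refine ⟨hconn, le_antisymm ?_ ?_⟩
  -- Every edge of the suppressed graph comes from a vertex outside `A`, either a leaf or a vertex
  -- of `M`, and each such vertex yields only one edge. Hence there are at most |C| - |A| < |C| -
  -- |M| ≤ m edges.
  · have hE : ∀ u, ∃ e : Sym2 (Fin m), u ∉ A →
        (u ∈ M → ∀ i j, i ≠ j → T.Adj u (ι i) → T.Adj u (ι j) → s(i, j) = e) ∧
        (u ∉ M → ∀ i j, ι i = u → T.Adj u (ι j) → s(i, j) = e) := by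
      intro u
      by_cases hA : u ∈ A
      · exact ⟨s(ρ u, ρ u), fun hA' => absurd hA hA'⟩
      by_cases hM : u ∈ M
      · obtain ⟨a, a', hne, hv⟩ := h.mid u hM
        refine ⟨s(ρ a, ρ a'), fun _ => ⟨fun _ i j hij hi hj => ?_, fun hM' => absurd hM hM'⟩⟩
        have key : ∀ v, v = ι i ∨ v = ι j ↔ v = a ∨ v = a' := fun v => by
          rw [← hv, h.mid_adj_iff hM (fun h => hij (hι h)) hi hj]
        rcases (key (ι i)).1 (Or.inl rfl) with h1 | h1 <;>
          rcases (key (ι j)).1 (Or.inr rfl) with h2 | h2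
        · exact absurd (hι (h1.trans h2.symm)) hij
        · rw [← h1, ← h2, hρι, hρι]
        · rw [← h1, ← h2, hρι, hρι, Sym2.eq_swap]
        · exact absurd (hι (h1.trans h2.symm)) hij
      · obtain ⟨a, ha⟩ := h.leaf u hA hM
        refine ⟨s(ρ u, ρ a), fun _ => ⟨fun hM' => absurd hM' hM, fun _ i j hi hj => ?_⟩⟩
        rw [← (ha _).1 hj, ← hi, hρι, hρι]
    choose E hE using hE
    have hsub : (suppress T M ι).edgeSet ⊆ E '' Aᶜ := by
      intro e
      induction e using Sym2.ind with
      | _ i j =>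
        rw [mem_edgeSet]
        rintro (hij | ⟨hne, b, hb, h1, h2⟩)
        · by_cases hi : ι i ∈ A
          · have hj := (h.adj _ _ hij).1 hi
            refine ⟨ι j, hj, ?_⟩
            rw [← (hE _ hj).2 (hιM j) j i rfl hij.symm, Sym2.eq_swap]
          · exact ⟨ι i, hi, ((hE _ hi).2 (hιM i) i j rfl hij).symm⟩
        · exact ⟨b, h.notMem b hb, ((hE _ (h.notMem b hb)).1 hb i j hne h1 h2).symm⟩
    have h1 : (suppress T M ι).edgeSet.ncard ≤ Aᶜ.ncard :=
      (Set.ncard_le_ncard hsub (Set.toFinite _)).trans (Set.ncard_image_le (Set.toFinite _))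
    have h2 : Mᶜ.ncard ≤ Nat.card (Fin m) := by
      rw [← Set.ncard_univ]
      refine (Set.ncard_le_ncard ?_ (Set.toFinite _)).trans
        (Set.ncard_image_le (f := ι) (Set.toFinite _))
      intro u hu
      obtain ⟨i, rfl⟩ := hιr u hu
      exact ⟨i, trivial, rfl⟩
    have h3 := Set.ncard_add_ncard_compl A
    have h4 := Set.ncard_add_ncard_compl M
    have h5 := h.card_lt
    rw [Nat.card_coe_set_eq]
    omega
  · exact hconn.card_vert_le_card_edgeSet_add_one

/-- Everything follows from the identity 2ℓ + d' = 2k+1 at each non-leaf: d' is odd, and k - ⌊d'/2⌋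
- ℓ = 0. -/
theorem isBaseTree_suppress [Finite C] (h : IsBranching k T A M) (hk : 2 ≤ k)
    (hι : Function.Injective ι) (hιM : ∀ i, ι i ∉ M) (hιr : ∀ u, u ∉ M → ∃ i, ι i = u) :
    IsBaseTree k (suppress T M ι) ∧ ∀ x, pendantCount k (suppress T M ι) x = 0 := by
  have hL := h.mem_leaves_iff hk hι hιM hιr
  have key : ∀ x, 2 * leafCount (suppress T M ι) x + coreDegree (suppress T M ι) x =
      2 * k + 1 := by
    rintro ⟨i, hi⟩
    have hiA : ι i ∈ A := by
      by_contra hcon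
      exact hi ((hL i).2 hcon)
    rw [← h.degree _ hiA, ← h.ncard_leaf_nbrs hι hιM hιr (i := i), ← h.ncard_core_nbrs hι hιr hiA]
    congr 1
    · unfold leafCount
      congr 2
      ext j
      simp [hL]
    · refine Set.ncard_congr (fun j _ => j.1) ?_ (fun _ _ _ _ hab => Subtype.ext hab) ?_
      · rintro ⟨j, hj⟩ hij
        refine ⟨?_, hij⟩
        by_contra hcon
        exact hj ((hL j).2 hcon)
      · rintro j ⟨hj, hij⟩
        exact ⟨⟨j, fun hj' => (hL j).1 hj' hj⟩, hij, rfl⟩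
  refine ⟨⟨h.isTree_suppress hι hιM hιr, fun x => ?_, fun x => (key x).le⟩, fun x => ?_⟩
  · have := key x
    exact ⟨coreDegree (suppress T M ι) x / 2, by omega, by omega⟩
  · have := key x
    unfold pendantCount
    omega

/-- Subdividing the core edges of the suppressed tree restores `M`. The constructor `pendant`
contributes nothing, since all pendant counts vanish. -/
theorem isSpecialTree [Finite C] (h : IsBranching k T A M) (hk : 2 ≤ k) : IsSpecialTree k T := by
  classical
  let e : Fin (Nat.card ↥Mᶜ) ≃ ↥Mᶜ := (Finite.equivFin _).symm
  obtain ⟨ι, hιdef⟩ : ∃ ι : Fin (Nat.card ↥Mᶜ) → C, ∀ i, ι i = e i := ⟨fun i => e i, fun _ => rfl⟩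
  have hι : Function.Injective ι := fun i j hij => by
    rw [hιdef, hιdef] at hij
    exact e.injective (Subtype.ext hij)
  have hιM : ∀ i, ι i ∉ M := fun i => hιdef i ▸ (e i).2
  have hιr : ∀ u, u ∉ M → ∃ i, ι i = u := fun u hu =>
    ⟨e.symm ⟨u, hu⟩, by rw [hιdef, Equiv.apply_symm_apply]⟩
  obtain ⟨hbase, hpend⟩ := h.isBaseTree_suppress hk hι hιM hιr
  have hL := h.mem_leaves_iff hk hι hιM hιr
  set R := suppress T M ι with hR
  have hA : ∀ x : ↥(leaves R)ᶜ, ι x ∈ A := fun x => by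
    by_contra hcon
    exact x.2 ((hL x).2 hcon)
  have hmid : ∀ e : ↥(core R).edgeSet, ∃ b ∈ M,
      ∀ x : ↥(leaves R)ᶜ, x ∈ (e : Sym2 ↥(leaves R)ᶜ) ↔ T.Adj b (ι x) := by
    rintro ⟨e, he⟩
    induction e using Sym2.ind with
    | _ x y =>
      have hxy : R.Adj x y := he
      obtain ⟨hne, b, hb, h1, h2⟩ := (h.suppress_adj_core (hA x) (hA y)).1 hxy
      refine ⟨b, hb, fun z => ?_⟩
      rw [h.mid_adj_iff hb (fun h => hne (hι h)) h1 h2, hι.eq_iff, hι.eq_iff, Sym2.mem_iff,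
        Subtype.ext_iff, Subtype.ext_iff]
  choose μ hμM hμ using hmid
  let F : TreeVertex k R → C
    | .old i => ι i
    | .mid e => μ e
    | .pendant x j => (Fin.cast (hpend x) j).elim0
  have hF : Function.Bijective F := by
    constructor
    · rintro (i | e | ⟨x, j⟩) (i' | e' | ⟨x', j'⟩) hab
      · exact congrArg _ (hι hab)
      · exact absurd (show ι i ∈ M from (show ι i = μ e' from hab) ▸ hμM e') (hιM i)
      · exact (Fin.cast (hpend x') j').elim0
      · exact absurd (show ι i' ∈ M from (show μ e = ι i' from hab) ▸ hμM e) (hιM i')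
      · have hee : μ e = μ e' := hab
        congr 1
        refine Subtype.ext (Sym2.ext fun x => ?_)
        rw [hμ, hμ, hee]
      · exact (Fin.cast (hpend x') j').elim0
      · exact (Fin.cast (hpend x) j).elim0
      · exact (Fin.cast (hpend x) j).elim0
      · exact (Fin.cast (hpend x) j).elim0
    · intro u
      by_cases hu : u ∈ M
      · obtain ⟨a, a', hne, hv⟩ := h.mid u hu
        have h1 := (hv a).2 (Or.inl rfl)
        have h2 := (hv a').2 (Or.inr rfl)
        obtain ⟨i, rfl⟩ := h.exists_index hιr (h.mem_of_adj_mid hu h1)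
        obtain ⟨j, rfl⟩ := h.exists_index hιr (h.mem_of_adj_mid hu h2)
        have hi : i ∈ (leaves R)ᶜ := fun hi => (hL i).1 hi (h.mem_of_adj_mid hu h1)
        have hj : j ∈ (leaves R)ᶜ := fun hj => (hL j).1 hj (h.mem_of_adj_mid hu h2)
        have hij : (core R).Adj ⟨i, hi⟩ ⟨j, hj⟩ :=
          show R.Adj i j from Or.inr ⟨fun h => hne (congrArg ι h), u, hu, h1, h2⟩
        refine ⟨.mid ⟨s(⟨i, hi⟩, ⟨j, hj⟩), hij⟩, ?_⟩
        refine (h.eq_of_adj _ hu _ (hμM _) fun v hv' => ?_).symm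
        rcases (hv v).1 hv' with rfl | rfl
        · exact (hμ _ ⟨i, hi⟩).1 (Sym2.mem_mk_left _ _)
        · exact (hμ _ ⟨j, hj⟩).1 (Sym2.mem_mk_right _ _)
      · obtain ⟨i, rfl⟩ := hιr u hu
        exact ⟨.old i, rfl⟩
  have hom : ∀ i e, treeRel k R (.old i) (.mid e) ↔ T.Adj (ι i) (μ e) := by
    intro i e
    constructor
    · rintro ⟨hi, hie⟩
      exact ((hμ e ⟨i, hi⟩).1 hie).symm
    · intro hadj
      have hi : i ∈ (leaves R)ᶜ := fun hi => (hL i).1 hi (h.mem_of_adj_mid (hμM e) hadj.symm)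
      exact ⟨hi, (hμ e ⟨i, hi⟩).2 hadj.symm⟩
  refine ⟨_, R, hbase, ⟨RelIso.symm ⟨Equiv.ofBijective F hF, ?_⟩⟩⟩
  rintro (i | e | ⟨x, j⟩) (i' | e' | ⟨x', j'⟩)
  · have key : treeRel k R (.old i) (.old i') ↔ T.Adj (ι i) (ι i') := by
      change R.Adj i i' ∧ (i ∈ leaves R ∨ i' ∈ leaves R) ↔ _
      rw [hL, hL]
      constructor
      · rintro ⟨h1, h2 | h2⟩
        · exact (h.suppress_adj_leaf h2).1 h1
        · exact ((h.suppress_adj_leaf h2).1 h1.symm).symm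
      · intro h1
        refine ⟨Or.inl h1, ?_⟩
        have := h.adj _ _ h1
        tauto
    have key' : treeRel k R (.old i') (.old i) ↔ T.Adj (ι i) (ι i') := by
      change R.Adj i' i ∧ (i' ∈ leaves R ∨ i ∈ leaves R) ↔ _
      rw [R.adj_comm, or_comm]
      exact key
    change T.Adj (ι i) (ι i') ↔ (fromRel (treeRel k R)).Adj _ _
    rw [fromRel_adj, key, key', or_self, and_iff_right_of_imp]
    rintro h1 h2
    injection h2 with h2
    exact h1.ne (congrArg ι h2)
  · change T.Adj (ι i) (μ e') ↔ (fromRel (treeRel k R)).Adj _ _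
    rw [fromRel_adj, hom]
    simp [treeRel]
  · exact (Fin.cast (hpend x') j').elim0
  · change T.Adj (μ e) (ι i') ↔ (fromRel (treeRel k R)).Adj _ _
    rw [fromRel_adj, hom, T.adj_comm]
    simp [treeRel]
  · change T.Adj (μ e) (μ e') ↔ (fromRel (treeRel k R)).Adj _ _
    have : ¬ T.Adj (μ e) (μ e') := fun h1 =>
      h.notMem _ (hμM e') (h.mem_of_adj_mid (hμM e) h1)
    simp [treeRel, this]
  · exact (Fin.cast (hpend x') j').elim0
  · exact (Fin.cast (hpend x) j).elim0
  · exact (Fin.cast (hpend x) j).elim0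
  · exact (Fin.cast (hpend x) j).elim0

end IsBranching

end ComponentFactor

/-! ### Components of the graph of a minimal token pair. -/

namespace ComponentFactor
open SimpleGraph Finset

theorem eq_of_load_eq_one {α β : Type*} [Fintype α] [DecidableEq β] {f g : α → β} {b : β}
    (h : load f g b = 1) {x y : α} (hx : f x = b ∨ g x = b) (hy : f y = b ∨ g y = b) : x = y := by
  classical
  have h1 : #{x | f x = b ∨ g x = b} ≤ 1 := by
    rw [filter_or, ← h]
    exact card_union_le _ _
  exact card_le_one.1 h1 x (by simpa using hx) y (by simpa using hy)

/-- `H` restricts on `I ∪ A` to the graph of all pairs along which a token of `(f, g)` is sent. -/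
structure IsTokenGraph {V : Type*} (H : SimpleGraph V) (I A : Finset V) (f g : I → A) : Prop where
  disjoint : Disjoint I A
  adj_sender : ∀ (x : I) v, H.Adj x v ↔ v = f x ∨ v = g x
  adj_receiver : ∀ (a : A) v, H.Adj a v ↔ ∃ x : I, v = x ∧ (f x = a ∨ g x = a)

namespace IsTokenGraph

variable {V : Type*} [DecidableEq V] {H : SimpleGraph V} {I A : Finset V} {f g : I → A}
  {t : I → Finset A} {k : ℕ}

theorem isStarCenter_sender (h : IsTokenGraph H I A f g) (hk : 2 ≤ k) {x : I} (hx : f x ≠ g x)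
    (hf : load f g (f x) = 1) (hg : load f g (g x) = 1) : IsStarCenter H k x := by
  have hcard : (H.neighborSet x).ncard = 2 := by
    rw [← Set.ncard_pair (fun heq => hx (Subtype.ext heq) : (f x : V) ≠ g x)]
    congr 1
    ext v
    simp [h.adj_sender]
  refine ⟨by omega, by omega, fun v w hxv hvw => ?_⟩
  rcases (h.adj_sender _ _).1 hxv with rfl | rfl
  · obtain ⟨y, rfl, hy⟩ := (h.adj_receiver _ _).1 hvw
    rw [eq_of_load_eq_one hf (Or.inl rfl) hy]
  · obtain ⟨y, rfl, hy⟩ := (h.adj_receiver _ _).1 hvw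
    rw [eq_of_load_eq_one hg (Or.inr rfl) hy]

/-- When no sender at `a` is split, the load of `a` is twice its degree. -/
theorem isStarCenter_receiver (h : IsTokenGraph H I A f g) {a : A} (h1 : 1 ≤ load f g a)
    (h2 : load f g a ≤ 2 * k) (ha : ∀ x, f x = a ∨ g x = a → f x = g x) :
    IsStarCenter H k a := by
  have hl := load_eq f g a
  have h0 : #{x | f x ≠ g x ∧ (f x = a ∨ g x = a)} = 0 := by
    simp only [card_eq_zero, filter_eq_empty_iff, mem_univ, true_imp_iff]
    exact fun x hx => hx.1 (ha x hx.2)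
  have hcard : (H.neighborSet a).ncard = #{x | f x = a ∧ g x = a} := by
    rw [← Set.ncard_coe_finset]
    symm
    refine Set.ncard_congr (fun x _ => (x : V)) ?_ (fun _ _ _ _ hxy => Subtype.ext hxy) ?_
    · intro x hx
      simp only [coe_filter, mem_univ, true_and, Set.mem_ofPred_eq] at hx
      exact (h.adj_receiver _ _).2 ⟨x, rfl, Or.inl hx.1⟩
    · intro v hv
      obtain ⟨x, rfl, hx⟩ := (h.adj_receiver _ _).1 hv
      have := ha x hx
      refine ⟨x, ?_, rfl⟩
      simp only [coe_filter, mem_univ, true_and, Set.mem_ofPred_eq]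
      rw [this, or_self] at hx
      rw [this, and_self]
      exact hx
  refine ⟨by omega, by omega, fun v w hav hvw => ?_⟩
  obtain ⟨x, rfl, hx⟩ := (h.adj_receiver _ _).1 hav
  have := ha x hx
  rw [this, or_self] at hx
  rw [h.adj_sender, this, or_self, hx] at hvw
  exact hvw

/-- The receivers are the branch vertices and the split senders have degree two. Saturation gives
the degree identity via `load_eq`; the absence of parallel paths and the final count both come from
`IsMinTokenPair.card_lt`. -/
theorem isBranching (h : IsTokenGraph H I A f g) (hm : IsMinTokenPair t (2 * k + 1) f g)
    {c : H.ConnectedComponent} {a₀ : A} (ha₀ : (a₀ : V) ∈ c.supp)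
    (hsat : ∀ a : A, (a : V) ∈ c.supp → load f g a = 2 * k + 1) :
    IsBranching k c.toSimpleGraph {u : c | (u : V) ∈ A}
      {u : c | ∃ x : I, (u : V) = x ∧ f x ≠ g x} := by
  classical
  have hIA : ∀ x : I, (x : V) ∉ A := fun x hx => disjoint_left.1 h.disjoint x.2 hx
  have hclosed : ∀ {u v}, u ∈ c.supp → H.Adj u v → v ∈ c.supp := fun {u v} hu huv => by
    rw [ConnectedComponent.mem_supp_iff] at hu ⊢
    rw [← hu]
    exact (ConnectedComponent.connectedComponentMk_eq_of_adj huv).symm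
  have hcov : ∀ u : c, (u : V) ∉ A → ∃ x : I, (u : V) = x := by
    rintro ⟨u, hu⟩ huA
    have hr : H.Reachable a₀ u := ConnectedComponent.exact
      (((ConnectedComponent.mem_supp_iff _ _).1 ha₀).trans
        ((ConnectedComponent.mem_supp_iff _ _).1 hu).symm)
    obtain ⟨p⟩ := hr
    -- No edge of `H` leaves `I ∪ A`, so the component of `a₀` stays inside it.
    suffices ∀ v w, H.Walk v w → (v ∈ A ∨ v ∈ I) → (w ∈ A ∨ w ∈ I) by
      rcases this _ _ p (Or.inl a₀.2) with h1 | h1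
      · exact absurd h1 huA
      · exact ⟨⟨u, h1⟩, rfl⟩
    intro v w p
    induction p with
    | nil => exact id
    | cons hvw _ ih =>
      rintro (hv | hv)
      · obtain ⟨x, rfl, -⟩ := (h.adj_receiver ⟨_, hv⟩ _).1 hvw
        exact ih (Or.inr x.2)
      · rcases (h.adj_sender ⟨_, hv⟩ _).1 hvw with rfl | rfl
        · exact ih (Or.inl (f _).2)
        · exact ih (Or.inl (g _).2)
  have hfc : ∀ x : I, (x : V) ∈ c.supp → (f x : V) ∈ c.supp := fun x hx =>
    hclosed hx ((h.adj_sender x _).2 (Or.inl rfl))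
  have hgc : ∀ x : I, (x : V) ∈ c.supp → (g x : V) ∈ c.supp := fun x hx =>
    hclosed hx ((h.adj_sender x _).2 (Or.inr rfl))
  have hadj : ∀ u v : c, c.toSimpleGraph.Adj u v ↔ H.Adj u v := fun u v => Iff.rfl
  have hfiber : ∀ (a : A) (P : I → Prop) [DecidablePred P],
      (a : V) ∈ c.supp → (∀ x, P x → f x = a ∨ g x = a) →
      {u : c | ∃ x : I, (u : V) = x ∧ P x}.ncard = #{x | P x} := by
    intro a P _ ha hP
    rw [← Set.ncard_coe_finset]
    symm
    have hxc : ∀ x : I, P x → (x : V) ∈ c.supp := fun x hx =>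
      hclosed ha ((h.adj_receiver a x).2 ⟨x, rfl, hP x hx⟩)
    refine Set.ncard_congr (fun x hx => ⟨(x : V), hxc x (by simpa using hx)⟩) ?_ ?_ ?_
    · intro x hx
      exact ⟨x, rfl, by simpa using hx⟩
    · intro x y _ _ hxy
      exact Subtype.ext (congrArg (fun u : c => (u : V)) hxy)
    · rintro ⟨u, hu⟩ ⟨x, hux, hx⟩
      exact ⟨x, by simpa using hx, Subtype.ext hux.symm⟩
  constructor
  · exact c.connected_toSimpleGraph
  · rintro u ⟨x, hx, -⟩ huA
    exact hIA x (hx ▸ huA)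
  · intro u v huv
    by_cases hu : (u : V) ∈ A
    · obtain ⟨x, hx, -⟩ := (h.adj_receiver ⟨_, hu⟩ _).1 ((hadj _ _).1 huv)
      have : (v : V) ∉ A := hx ▸ hIA x
      exact iff_of_true hu this
    · obtain ⟨x, hx⟩ := hcov u hu
      have hv : (v : V) ∈ A := by
        rw [hadj, hx, h.adj_sender] at huv
        rcases huv with h1 | h1 <;> rw [h1]
        · exact (f x).2
        · exact (g x).2
      exact iff_of_false hu (not_not.2 hv)
  · intro u huA huM
    obtain ⟨x, hx⟩ := hcov u huA
    have hfg : f x = g x := by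
      by_contra hcon
      exact huM ⟨x, hx, hcon⟩
    refine ⟨⟨f x, hfc x (hx ▸ u.2)⟩, fun v => ?_⟩
    have key : H.Adj u v ↔ (v : V) = f x := by
      rw [hx, h.adj_sender, hfg, or_self]
    rw [hadj, key, Subtype.ext_iff]
  · rintro u ⟨x, hx, hfg⟩
    refine ⟨⟨f x, hfc x (hx ▸ u.2)⟩, ⟨g x, hgc x (hx ▸ u.2)⟩,
      fun heq => hfg (Subtype.ext (congrArg (fun u : c => (u : V)) heq)), fun v => ?_⟩
    have key : H.Adj u v ↔ (v : V) = f x ∨ (v : V) = g x := by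
      rw [hx, h.adj_sender]
    rw [hadj, key, Subtype.ext_iff, Subtype.ext_iff]
  · rintro u ⟨x, hx, hxfg⟩ v ⟨y, hy, hyfg⟩ huv
    by_contra hne
    have hxy : x ≠ y := fun heq => hne (Subtype.ext (by rw [hx, hy, heq]))
    -- Two split senders with the same two receivers would form a cycle of length four.
    have key := hm.card_lt (B := {x, y}) ⟨x, by simp⟩
      (fun z hz => by rcases mem_insert.1 hz with rfl | hz
                      · exact hxfg
                      · rwa [mem_singleton.1 hz])
    rw [card_pair hxy] at key
    have hmem : ∀ a : A, (a : V) = f x ∨ (a : V) = g x → a = f y ∨ a = g y := by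
      intro a ha
      have hac : (a : V) ∈ c.supp := by
        rcases ha with ha | ha <;> rw [ha]
        · exact hfc x (hx ▸ u.2)
        · exact hgc x (hx ▸ u.2)
      have h1 := huv ⟨a, hac⟩ (by rw [hadj, hx, h.adj_sender]; exact ha)
      rw [hadj, hy, h.adj_sender] at h1
      exact h1.imp Subtype.ext Subtype.ext
    have hsub : image f {x, y} ∪ image g {x, y} ⊆ {f y, g y} := by
      intro a ha
      simp only [image_insert, image_singleton, mem_union, mem_insert, mem_singleton] at ha ⊢
      rcases ha with (rfl | rfl) | (rfl | rfl)
      · exact hmem _ (Or.inl rfl)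
      · exact Or.inl rfl
      · exact hmem _ (Or.inr rfl)
      · exact Or.inr rfl
    have := (card_le_card hsub).trans card_le_two
    omega
  · rintro ⟨a, hac⟩ haA
    have hl := load_eq f g ⟨a, haA⟩
    rw [hsat ⟨a, haA⟩ hac, ← hfiber ⟨a, haA⟩ _ hac (fun x hx => Or.inl hx.1),
      ← hfiber ⟨a, haA⟩ _ hac (fun x hx => hx.2)] at hl
    rw [hl]
    congr 2
    · congr 1
      ext u
      constructor
      · rintro ⟨huA, huM, hu⟩
        obtain ⟨x, hux, hx⟩ := (h.adj_receiver ⟨a, haA⟩ _).1 ((hadj _ _).1 hu)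
        have hfg : f x = g x := by
          by_contra hcon
          exact huM ⟨x, hux, hcon⟩
        rw [hfg, or_self] at hx
        exact ⟨x, hux, hfg.trans hx, hx⟩
      · rintro ⟨x, hux, hfx, hgx⟩
        refine ⟨fun huA => hIA x (hux ▸ huA), ?_,
          (h.adj_receiver ⟨a, haA⟩ _).2 ⟨x, hux, Or.inl hfx⟩⟩
        rintro ⟨y, huy, hy⟩
        obtain rfl : x = y := Subtype.ext (hux.symm.trans huy)
        exact hy (hfx.trans hgx.symm)
    · ext u
      constructor
      · rintro ⟨⟨y, huy, hy⟩, hu⟩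
        obtain ⟨x, hux, hx⟩ := (h.adj_receiver ⟨a, haA⟩ _).1 ((hadj _ _).1 hu)
        obtain rfl : x = y := Subtype.ext (hux.symm.trans huy)
        exact ⟨x, hux, hy, hx⟩
      · rintro ⟨x, hux, hfg, hx⟩
        exact ⟨⟨x, hux, hfg⟩, (h.adj_receiver ⟨a, haA⟩ _).2 ⟨x, hux, hx⟩⟩
  · have hAfin : {u : c | (u : V) ∈ A}.Finite :=
      Set.Finite.preimage Subtype.val_injective.injOn A.finite_toSet
    set B : Finset I := {x | (x : V) ∈ c.supp ∧ f x ≠ g x} with hB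
    have hM : {u : c | ∃ x : I, (u : V) = x ∧ f x ≠ g x}.ncard = #B := by
      rw [← Set.ncard_coe_finset]
      symm
      refine Set.ncard_congr (fun x hx => ⟨(x : V), (mem_filter.1 (mem_coe.1 hx)).2.1⟩) ?_ ?_ ?_
      · intro x hx
        exact ⟨x, rfl, (mem_filter.1 (mem_coe.1 hx)).2.2⟩
      · intro x y _ _ hxy
        exact Subtype.ext (congrArg (fun u : c => (u : V)) hxy)
      · rintro ⟨u, hu⟩ ⟨x, hux, hx⟩
        exact ⟨x, by simpa [hB] using ⟨hux ▸ hu, hx⟩, Subtype.ext hux.symm⟩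
    rw [hM]
    rcases B.eq_empty_or_nonempty with hBe | hBn
    · rw [hBe, card_empty, Set.ncard_pos hAfin]
      exact ⟨⟨a₀, ha₀⟩, a₀.2⟩
    · refine (hm.card_lt hBn fun x hx => (mem_filter.1 hx).2.2).trans_le ?_
      rw [← Set.ncard_coe_finset]
      have hmem : ∀ a ∈ (↑(image f B ∪ image g B) : Set A), (a : V) ∈ c.supp := by
        intro a ha
        rw [mem_coe, mem_union, mem_image, mem_image] at ha
        rcases ha with ⟨x, hx, rfl⟩ | ⟨x, hx, rfl⟩
        · exact hfc x (mem_filter.1 hx).2.1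
        · exact hgc x (mem_filter.1 hx).2.1
      -- The default value `a₀` is never taken on the receivers of `B`, which all lie in the
      -- component.
      refine Set.ncard_le_ncard_of_injOn (fun a => if ha : (a : V) ∈ c.supp then (⟨a, ha⟩ : c)
        else ⟨a₀, ha₀⟩) ?_ ?_ hAfin
      · intro a ha
        simp only [hmem a ha, dite_true]
        exact a.2
      · intro a ha b hb hab
        simp only [hmem a ha, hmem b hb, dite_true] at hab
        exact Subtype.ext (congrArg (fun u : c => (u : V)) hab)

theorem isSmallStar_or_isSpecialTree [Finite V] (h : IsTokenGraph H I A f g) (hk : 2 ≤ k)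
    (hm : IsMinTokenPair t (2 * k + 1) f g) {c : H.ConnectedComponent} {a₀ : A}
    (ha₀ : (a₀ : V) ∈ c.supp) :
    IsSmallStar k c.toSimpleGraph ∨ IsSpecialTree k c.toSimpleGraph := by
  have hclosed : ∀ {u v}, u ∈ c.supp → H.Adj u v → v ∈ c.supp := fun {u v} hu huv => by
    rw [ConnectedComponent.mem_supp_iff] at hu ⊢
    rw [← hu]
    exact (ConnectedComponent.connectedComponentMk_eq_of_adj huv).symm
  by_cases hsat : ∀ a : A, (a : V) ∈ c.supp → load f g a = 2 * k + 1
  · exact Or.inr ((h.isBranching hm ha₀ hsat).isSpecialTree hk)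
  left
  push Not at hsat
  obtain ⟨a, hac, ha⟩ := hsat
  have hle := hm.le a
  by_cases hx : ∀ x, f x = a ∨ g x = a → f x = g x
  · exact (h.isStarCenter_receiver (hm.pos a) (by omega) hx).isSmallStar hac
  · push Not at hx
    obtain ⟨x, hxa, hfg⟩ := hx
    have hxc : (x : V) ∈ c.supp := hclosed hac ((h.adj_receiver a _).2 ⟨x, rfl, hxa⟩)
    -- The unsaturated receiver forces load 1 at the other one; that receiver is then unsaturated
    -- too and forces load 1 back.
    rcases hxa with rfl | rfl
    · have h1 := hm.load_right_eq_one hfg (by omega)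
      exact (h.isStarCenter_sender hk hfg (hm.load_left_eq_one hfg (by omega)) h1).isSmallStar hxc
    · have h1 := hm.load_left_eq_one hfg (by omega)
      exact (h.isStarCenter_sender hk hfg h1 (hm.load_right_eq_one hfg (by omega))).isSmallStar hxc

end IsTokenGraph

end ComponentFactor

/-! ### Decomposition along an independent set of maximum deficiency, and the proof of (i). -/

namespace ComponentFactor
open SimpleGraph Finset

section Decomposition

variable {V : Type*} [Fintype V] [DecidableEq V] (G : SimpleGraph V) [DecidableRel G.Adj]

/-- The set of all vertices with a neighbor in `s`. -/
def nbrs (s : Finset V) : Finset V := s.biUnion fun v => G.neighborFinset v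

variable {G}

theorem mem_nbrs {s : Finset V} {w : V} : w ∈ nbrs G s ↔ ∃ v ∈ s, G.Adj v w := by
  simp [nbrs]

/-- An independent set for which `#I - #(nbrs I)` is as large as possible. -/
structure IsMaxDeficient (G : SimpleGraph V) [DecidableRel G.Adj] (I : Finset V) : Prop where
  indep : G.IsIndepSet I
  max : ∀ J : Finset V, G.IsIndepSet J → #J + #(nbrs G I) ≤ #I + #(nbrs G J)

variable (G) in
theorem exists_isMaxDeficient : ∃ I : Finset V, IsMaxDeficient G I := by
  classical
  obtain ⟨I, hI, hmax⟩ := exists_max_image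
    (univ.filter fun I : Finset V => G.IsIndepSet I)
    (fun I => (#I : ℤ) - #(nbrs G I)) ⟨∅, by simp⟩
  simp only [mem_filter, mem_univ, true_and] at hI hmax
  exact ⟨I, hI, fun J hJ => by have := hmax J hJ; omega⟩

namespace IsMaxDeficient

variable {I : Finset V}

theorem disjoint (h : IsMaxDeficient G I) : Disjoint I (nbrs G I) := by
  rw [Finset.disjoint_left]
  intro w hw hw'
  obtain ⟨v, hv, hvw⟩ := mem_nbrs.1 hw'
  exact h.indep hv hw hvw.ne hvw

/-- Removing the neighbors of `Y` from `I` leaves an independent set whose neighborhood misses `Y`;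
its deficiency is no larger than that of `I`. -/
theorem card_le_inter (h : IsMaxDeficient G I) {Y : Finset V} (hY : Y ⊆ nbrs G I) :
    #Y ≤ #(nbrs G Y ∩ I) := by
  have h1 := h.max (I \ nbrs G Y) fun u hu v hv =>
    h.indep (mem_sdiff.1 (mem_coe.1 hu)).1 (mem_sdiff.1 (mem_coe.1 hv)).1
  have h2 : nbrs G (I \ nbrs G Y) ⊆ nbrs G I \ Y := by
    intro w hw
    obtain ⟨v, hv, hvw⟩ := mem_nbrs.1 hw
    rw [mem_sdiff] at hv
    refine mem_sdiff.2 ⟨mem_nbrs.2 ⟨v, hv.1, hvw⟩, fun hwY => ?_⟩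
    exact hv.2 (mem_nbrs.2 ⟨w, hwY, hvw.symm⟩)
  have h3 := card_le_card h2
  rw [card_sdiff_of_subset hY] at h3
  have h4 := card_sdiff_add_card_inter I (nbrs G Y)
  rw [inter_comm] at h4
  have h5 := card_le_card hY
  omega

/-- The set `I ∪ J` is independent, and its only new neighbors are those of `J` in the rest; compare
deficiencies. -/
theorem card_le_rest_of_isIndepSet (h : IsMaxDeficient G I) {J : Finset V}
    (hJ : J ⊆ (I ∪ nbrs G I)ᶜ) (hind : G.IsIndepSet J) :
    #J ≤ #(nbrs G J ∩ (I ∪ nbrs G I)ᶜ) := by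
  have hIJ : ∀ u ∈ I, ∀ v ∈ J, ¬ G.Adj u v := by
    intro u hu v hv huv
    have := hJ hv
    rw [mem_compl, mem_union, not_or] at this
    exact this.2 (mem_nbrs.2 ⟨u, hu, huv⟩)
  have hdisj : Disjoint I J := Finset.disjoint_left.2 fun v hv hv' => by
    have := hJ hv'
    rw [mem_compl, mem_union, not_or] at this
    exact this.1 hv
  have h1 := h.max (I ∪ J) <| by
    intro u hu v hv hne huv
    rw [mem_coe, mem_union] at hu hv
    rcases hu with hu | hu <;> rcases hv with hv | hv
    · exact h.indep hu hv hne huv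
    · exact hIJ u hu v hv huv
    · exact hIJ v hv u hu huv.symm
    · exact hind hu hv hne huv
  have h2 : nbrs G (I ∪ J) ⊆ nbrs G I ∪ (nbrs G J ∩ (I ∪ nbrs G I)ᶜ) := by
    intro w hw
    obtain ⟨v, hv, hvw⟩ := mem_nbrs.1 hw
    rcases mem_union.1 hv with hv | hv
    · exact mem_union_left _ (mem_nbrs.2 ⟨v, hv, hvw⟩)
    · by_cases hwI : w ∈ nbrs G I
      · exact mem_union_left _ hwI
      · refine mem_union_right _ (mem_inter.2 ⟨mem_nbrs.2 ⟨v, hv, hvw⟩, ?_⟩)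
        rw [mem_compl, mem_union, not_or]
        exact ⟨fun hw' => hIJ w hw' v hv hvw.symm, hwI⟩
  have h3 := (card_le_card h2).trans (card_union_le _ _)
  rw [card_union_of_disjoint hdisj] at h1
  omega

/-- Let `J` be the set of isolated vertices of `G[s]`. The vertices of `s \ J` are themselves
neighbors of `s`, and the independent set `J` has enough neighbors in the rest, all outside `s`. -/
theorem card_le_rest (h : IsMaxDeficient G I) {s : Finset V} (hs : s ⊆ (I ∪ nbrs G I)ᶜ) :
    #s ≤ #(nbrs G s ∩ (I ∪ nbrs G I)ᶜ) := by
  set J := s.filter fun v => ∀ w ∈ s, ¬ G.Adj v w with hJ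
  have hJs : J ⊆ s := filter_subset _ _
  have h1 := h.card_le_rest_of_isIndepSet (hJs.trans hs) fun u hu v hv _ huv =>
    (mem_filter.1 (mem_coe.1 hu)).2 v (hJs (mem_coe.1 hv)) huv
  have h2 : (s \ J) ∪ (nbrs G J ∩ (I ∪ nbrs G I)ᶜ) ⊆ nbrs G s ∩ (I ∪ nbrs G I)ᶜ := by
    intro w hw
    rcases mem_union.1 hw with hw | hw
    · obtain ⟨hws, hwJ⟩ := mem_sdiff.1 hw
      have : ∃ v ∈ s, G.Adj w v := by
        by_contra hcon
        push Not at hcon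
        exact hwJ (mem_filter.2 ⟨hws, hcon⟩)
      obtain ⟨v, hv, hwv⟩ := this
      exact mem_inter.2 ⟨mem_nbrs.2 ⟨v, hv, hwv.symm⟩, hs hws⟩
    · obtain ⟨hw1, hw2⟩ := mem_inter.1 hw
      obtain ⟨v, hv, hvw⟩ := mem_nbrs.1 hw1
      exact mem_inter.2 ⟨mem_nbrs.2 ⟨v, hJs hv, hvw⟩, hw2⟩
  have h3 : Disjoint (s \ J) (nbrs G J ∩ (I ∪ nbrs G I)ᶜ) := by
    rw [Finset.disjoint_left]
    intro w hw hw'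
    obtain ⟨v, hv, hvw⟩ := mem_nbrs.1 (mem_inter.1 hw').1
    exact (mem_filter.1 hv).2 w (mem_sdiff.1 hw).1 hvw
  have h4 := card_le_card h2
  rw [card_union_of_disjoint h3] at h4
  have h5 := card_sdiff_add_card_eq_card hJs
  omega

/-- Hall's theorem with `card_le_inter` gives distinct senders for the receivers, which secures the
lower bound on loads; `hG` secures the capacity. -/
theorem exists_isMinTokenPair (h : IsMaxDeficient G I) {k : ℕ}
    (hG : ∀ s : Finset V, G.IsIndepSet s → 2 * #s ≤ (2 * k + 1) * #(nbrs G s)) :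
    ∃ f g : I → nbrs G I,
      IsMinTokenPair (fun x : I => univ.filter fun a : nbrs G I => G.Adj x a) (2 * k + 1) f g := by
  have hY : ∀ s : Finset (nbrs G I),
      #s ≤ #(s.biUnion fun a => univ.filter fun x : I => G.Adj x a) := by
    intro s
    have h1 := h.card_le_inter (map_subtype_subset s)
    rw [card_map] at h1
    refine h1.trans ?_
    rw [← card_map (.subtype (· ∈ I)) (s := s.biUnion _)]
    refine card_le_card fun x hx => ?_
    obtain ⟨hx, hxI⟩ := mem_inter.1 hx
    obtain ⟨v, hv, hvx⟩ := mem_nbrs.1 hx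
    obtain ⟨a, ha, rfl⟩ := mem_map.1 hv
    exact mem_map.2 ⟨⟨x, hxI⟩, mem_biUnion.2 ⟨a, ha, by simpa using hvx.symm⟩, rfl⟩
  obtain ⟨e, he, hem⟩ := (all_card_le_biUnion_card_iff_exists_injective _).1 hY
  refine ComponentFactor.exists_isMinTokenPair _ (by omega) (fun s => ?_) e he
    fun b => by simpa using hem b
  have h1 := hG (s.map (.subtype _)) fun u hu v hv =>
    h.indep (map_subtype_subset s hu) (map_subtype_subset s hv)
  rw [card_map] at h1
  refine h1.trans (Nat.mul_le_mul_left _ ?_)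
  rw [← card_map (.subtype (· ∈ nbrs G I)) (s := s.biUnion _)]
  refine card_le_card fun w hw => ?_
  obtain ⟨v, hv, hvw⟩ := mem_nbrs.1 hw
  obtain ⟨x, hx, rfl⟩ := mem_map.1 hv
  exact mem_map.2 ⟨⟨w, mem_nbrs.2 ⟨x, x.2, hvw⟩⟩, mem_biUnion.2 ⟨x, hx, by simpa using hvw⟩, rfl⟩

end IsMaxDeficient

theorem hasStarTreeFactor_of_card_le {k : ℕ} (hk : 2 ≤ k)
    (hG : ∀ s : Finset V, G.IsIndepSet s → 2 * #s ≤ (2 * k + 1) * #(nbrs G s)) :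
    HasStarTreeFactor k G := by
  obtain ⟨I, hI⟩ := exists_isMaxDeficient G
  obtain ⟨f, g, hfg⟩ := hI.exists_isMinTokenPair hG
  have hIA : ∀ x ∈ I, x ∉ nbrs G I := fun x hx hx' => Finset.disjoint_left.1 hI.disjoint hx hx'
  obtain ⟨S, hSG, hSQ, hS⟩ := exists_star_cover G (I ∪ nbrs G I)ᶜ fun s hs => by
    rw [← biUnion_inter]
    exact hI.card_le_rest hs
  have hf : ∀ x : I, G.Adj x (f x) := fun x => by simpa using hfg.left_mem x
  have hg : ∀ x : I, G.Adj x (g x) := fun x => by simpa using hfg.right_mem x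
  let F : SimpleGraph V :=
    { Adj := fun u v => ∃ x : I, (u = x ∧ (v = f x ∨ v = g x)) ∨ (v = x ∧ (u = f x ∨ u = g x))
      symm := ⟨fun u v ⟨x, hx⟩ => ⟨x, hx.symm⟩⟩
      loopless := ⟨fun u ⟨x, hx⟩ => by
        have hx' : u = x ∧ (u = f x ∨ u = g x) := hx.elim id id
        obtain ⟨rfl, hx | hx⟩ := hx'
        · exact (hf x).ne hx
        · exact (hg x).ne hx⟩ }
  have hFG : F ≤ G := by
    rintro u v ⟨x, ⟨rfl, rfl | rfl⟩ | ⟨rfl, rfl | rfl⟩⟩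
    · exact hf x
    · exact hg x
    · exact (hf x).symm
    · exact (hg x).symm
  have hFQ : ∀ u v, F.Adj u v → u ∉ (I ∪ nbrs G I)ᶜ := by
    rintro u v ⟨x, ⟨rfl, -⟩ | ⟨-, rfl | rfl⟩⟩
    · simp
    · simp [-SetLike.coe_mem, (f x).2]
    · simp [-SetLike.coe_mem, (g x).2]
  have hSI : ∀ u v, u ∈ I ∨ u ∈ nbrs G I → ¬ S.Adj u v := fun u v hu huv => by
    have := (hSQ u v huv).1
    rw [mem_compl, mem_union] at this
    exact this hu
  have htok : IsTokenGraph (F ⊔ S) I (nbrs G I) f g := by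
    refine ⟨hI.disjoint, fun x v => ?_, fun a v => ?_⟩
    · rw [sup_adj, or_iff_left (hSI _ _ (Or.inl x.2))]
      constructor
      · rintro ⟨y, ⟨hxy, hv⟩ | ⟨-, hx | hx⟩⟩
        · rwa [← Subtype.ext hxy] at hv
        · exact absurd (hx ▸ (f y).2) (hIA x x.2)
        · exact absurd (hx ▸ (g y).2) (hIA x x.2)
      · exact fun hv => ⟨x, Or.inl ⟨rfl, hv⟩⟩
    · rw [sup_adj, or_iff_left (hSI _ _ (Or.inr a.2))]
      constructor
      · rintro ⟨x, ⟨hax, -⟩ | ⟨hv, hax⟩⟩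
        · exact absurd (hax ▸ a.2) (hIA x x.2)
        · exact ⟨x, hv, hax.imp (fun h => (Subtype.ext h).symm) fun h => (Subtype.ext h).symm⟩
      · rintro ⟨x, hv, rfl | rfl⟩
        · exact ⟨x, Or.inr ⟨hv, Or.inl rfl⟩⟩
        · exact ⟨x, Or.inr ⟨hv, Or.inr rfl⟩⟩
  refine ⟨F ⊔ S, sup_le hFG hSG, fun c => ?_⟩
  obtain ⟨v, hv⟩ := c.nonempty_supp
  by_cases hvA : v ∈ nbrs G I
  · exact htok.isSmallStar_or_isSpecialTree hk hfg (a₀ := ⟨v, hvA⟩) hv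
  have hclosed : ∀ {u}, (F ⊔ S).Adj v u → u ∈ c.supp := fun {u} huv => by
    rw [ConnectedComponent.mem_supp_iff] at hv ⊢
    rw [← hv]
    exact (ConnectedComponent.connectedComponentMk_eq_of_adj huv).symm
  by_cases hvI : v ∈ I
  · exact htok.isSmallStar_or_isSpecialTree hk hfg (a₀ := f ⟨v, hvI⟩)
      (hclosed ((htok.adj_sender ⟨v, hvI⟩ _).2 (Or.inl rfl)))
  · have hvQ : v ∈ (I ∪ nbrs G I)ᶜ := by simp [hvA, hvI]
    obtain ⟨z, hz, hvz⟩ := hS v hvQ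
    have hFS : ∀ u ∈ (I ∪ nbrs G I)ᶜ, ∀ w, (F ⊔ S).Adj u w ↔ S.Adj u w := fun u hu w => by
      rw [sup_adj, or_iff_right fun h => hFQ u w h hu]
    have hzQ : z ∈ (I ∪ nbrs G I)ᶜ := by
      rcases hvz with rfl | hvz
      · exact hvQ
      · exact (hSQ _ _ hvz).1
    have hzc : z ∈ c.supp := by
      rcases hvz with rfl | hvz
      · exact hv
      · exact hclosed (Or.inr hvz.symm)
    have hnb : (F ⊔ S).neighborSet z = S.neighborSet z := Set.ext fun w => hFS z hzQ w
    -- The stars covering the rest have at most two leaves, which is allowed because `2 ≤ k`.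
    refine Or.inl (IsStarCenter.isSmallStar ⟨hnb ▸ hz.one_le, hnb ▸ hz.le.trans hk, ?_⟩ hzc)
    intro u w hzu huw
    rw [hFS z hzQ] at hzu
    rw [hFS u (hSQ _ _ hzu).2] at huw
    exact hz.eq_of_adj _ _ hzu huw

end Decomposition

/-- A nonempty independent `s` has at most α(G) vertices and at least δ(G) neighbors, those of any
one of its vertices. -/
theorem hasStarTreeFactor_of_le_minDegree {V : Type*} [Fintype V] {G : SimpleGraph V}
    [DecidableRel G.Adj] {k : ℕ} (hk : 2 ≤ k)
    (h : (2 * (G.indepNum : ℝ)) / (2 * (k : ℝ) + 1) ≤ (G.minDegree : ℝ)) :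
    HasStarTreeFactor k G := by
  classical
  have h' : 2 * G.indepNum ≤ (2 * k + 1) * G.minDegree := by
    rw [div_le_iff₀ (by positivity)] at h
    rw [mul_comm (2 * k + 1)]
    exact_mod_cast h
  refine hasStarTreeFactor_of_card_le hk fun s hs => ?_
  rcases s.eq_empty_or_nonempty with rfl | ⟨v, hv⟩
  · simp
  calc 2 * #s ≤ 2 * G.indepNum := Nat.mul_le_mul_left _ hs.card_le_indepNum
    _ ≤ (2 * k + 1) * G.minDegree := h'
    _ ≤ (2 * k + 1) * #(nbrs G s) := by
      refine Nat.mul_le_mul_left _ ((G.minDegree_le_degree v).trans (card_le_card fun w hw => ?_))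
      exact mem_nbrs.2 ⟨v, hv, by simpa using hw⟩

end ComponentFactor

/-! ### The weight argument: a necessary condition for a factor. -/

namespace ComponentFactor
open SimpleGraph

section Weight

/-- The weight that `v` receives if every vertex distributes the weight two equally among its
neighbors. -/
noncomputable def weight {V : Type*} (H : SimpleGraph V) (v : V) : ℚ :=
  ∑ᶠ u ∈ H.neighborSet v, 2 / ((H.neighborSet u).ncard : ℚ)

/-- `v` is not isolated, and it receives at most the weight `2k+1`. -/
def IsLight {V : Type*} (k : ℕ) (H : SimpleGraph V) (v : V) : Prop :=
  1 ≤ (H.neighborSet v).ncard ∧ weight H v ≤ 2 * k + 1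

theorem IsLight.map {C V : Type*} {k : ℕ} {T : SimpleGraph C} {H : SimpleGraph V} {φ : C → V}
    (hφ : Function.Injective φ) (hn : ∀ u, H.neighborSet (φ u) = φ '' T.neighborSet u) {u : C}
    (hu : IsLight k T u) : IsLight k H (φ u) := by
  have hcard : ∀ u, (H.neighborSet (φ u)).ncard = (T.neighborSet u).ncard := fun u => by
    rw [hn, Set.ncard_image_of_injective _ hφ]
  have hw : weight H (φ u) = weight T u := by
    unfold weight
    rw [hn, finsum_mem_image hφ.injOn]
    simp only [hcard]
  exact ⟨hcard u ▸ hu.1, hw ▸ hu.2⟩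

theorem IsLight.of_iso {C D : Type*} {k : ℕ} {T : SimpleGraph C} {T' : SimpleGraph D}
    (e : T ≃g T') (h : ∀ u, IsLight k T' u) (u : C) : IsLight k T u := by
  have := (h (e u)).map (H := T) e.symm.injective fun w => by
    ext v
    constructor
    · intro hv
      exact ⟨e v, by simpa using e.map_adj_iff.2 hv, by simp⟩
    · rintro ⟨v, hv, rfl⟩
      exact e.symm.map_adj_iff.2 hv
  simpa using this

/-- A neighbor of degree at least two passes on at most 1, and any neighbor at most 2. -/
theorem weight_le {V : Type*} [Finite V] (H : SimpleGraph V) (v : V) {s t : Set V}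
    (hst : H.neighborSet v ⊆ s ∪ t) (hd : Disjoint s t)
    (ht : ∀ u ∈ t, 2 ≤ (H.neighborSet u).ncard) :
    weight H v ≤ 2 * s.ncard + t.ncard := by
  classical
  have := Fintype.ofFinite V
  have h2 : ∀ n : ℕ, (2 : ℚ) / n ≤ 2 := fun n => by
    rcases Nat.eq_zero_or_pos n with rfl | hn
    · simp
    · exact div_le_self (by norm_num) (by exact_mod_cast hn)
  have h1 : ∀ n : ℕ, 2 ≤ n → (2 : ℚ) / n ≤ 1 := fun n hn => by
    rw [div_le_one (by positivity)]
    exact_mod_cast hn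
  have h0 : ∀ n : ℕ, (0 : ℚ) ≤ 2 / n := fun n => by positivity
  unfold weight
  rw [finsum_mem_eq_toFinset_sum, Set.ncard_eq_toFinset_card', Set.ncard_eq_toFinset_card']
  calc ∑ u ∈ (H.neighborSet v).toFinset, 2 / ((H.neighborSet u).ncard : ℚ)
      ≤ ∑ u ∈ s.toFinset ∪ t.toFinset, 2 / ((H.neighborSet u).ncard : ℚ) := by
        refine Finset.sum_le_sum_of_subset_of_nonneg ?_ fun _ _ _ => h0 _
        rw [← Set.toFinset_union]
        exact Set.toFinset_mono hst
    _ = ∑ u ∈ s.toFinset, 2 / ((H.neighborSet u).ncard : ℚ) +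
          ∑ u ∈ t.toFinset, 2 / ((H.neighborSet u).ncard : ℚ) :=
        Finset.sum_union (Set.disjoint_toFinset.2 hd)
    _ ≤ s.toFinset.card • (2 : ℚ) + t.toFinset.card • (1 : ℚ) :=
        add_le_add (Finset.sum_le_card_nsmul _ _ _ fun _ _ => h2 _)
          (Finset.sum_le_card_nsmul _ _ _ fun u hu => h1 _ (ht u (Set.mem_toFinset.1 hu)))
    _ = 2 * s.toFinset.card + t.toFinset.card := by
        simp only [nsmul_eq_mul]
        ring

theorem isLight_of_ncard_le {V : Type*} [Finite V] {H : SimpleGraph V} {v : V} {k : ℕ}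
    (h1 : 1 ≤ (H.neighborSet v).ncard) (hk : (H.neighborSet v).ncard ≤ k) : IsLight k H v := by
  refine ⟨h1, ?_⟩
  have := weight_le H v (s := H.neighborSet v) (t := ∅) (by simp) (by simp) (by simp)
  rw [Set.ncard_empty, Nat.cast_zero, add_zero] at this
  have hk' : ((H.neighborSet v).ncard : ℚ) ≤ k := by exact_mod_cast hk
  linarith

theorem IsSmallStar.isLight {C : Type*} {k : ℕ} {T : SimpleGraph C} (h : IsSmallStar k T) (u : C) :
    IsLight k T u := by
  obtain ⟨j, hj1, hjk, ⟨e⟩⟩ := h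
  refine IsLight.of_iso e (fun v => ?_) u
  rcases v with a | b
  · have : (completeBipartiteGraph (Fin 1) (Fin j)).neighborSet (Sum.inl a) = Set.range Sum.inr := by
      ext (v | v) <;> simp
    have hc : (Set.range (Sum.inr : Fin j → Fin 1 ⊕ Fin j)).ncard = j := by
      rw [← Set.image_univ, Set.ncard_image_of_injective _ Sum.inr_injective, Set.ncard_univ,
        Nat.card_fin]
    exact isLight_of_ncard_le (by rw [this, hc]; exact hj1) (by rw [this, hc]; exact hjk)
  · have : (completeBipartiteGraph (Fin 1) (Fin j)).neighborSet (Sum.inr b) = {Sum.inl 0} := by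
      ext (v | v)
      · simp [Subsingleton.elim v 0]
      · simp
    refine isLight_of_ncard_le ?_ ?_ <;> rw [this, Set.ncard_singleton]
    omega

section TreeOf

variable {W : Type*} {k : ℕ} {R : SimpleGraph W}

instance [Finite W] : Finite (TreeVertex k R) := by
  refine Finite.of_surjective (α := W ⊕ ↥(core R).edgeSet ⊕
    Σ x : ↥(leaves R)ᶜ, Fin (pendantCount k R x))
    (Sum.elim .old (Sum.elim .mid fun p => .pendant p.1 p.2)) ?_
  rintro (v | e | ⟨x, i⟩)
  · exact ⟨.inl v, rfl⟩
  · exact ⟨.inr (.inl e), rfl⟩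
  · exact ⟨.inr (.inr ⟨x, i⟩), rfl⟩

theorem neighborSet_treeOf_mid {x y : ↥(leaves R)ᶜ} (h : (core R).Adj x y) :
    (treeOf k R).neighborSet (.mid ⟨s(x, y), h⟩) = {.old x.1, .old y.1} := by
  ext (v | e | ⟨z, i⟩)
  · simp only [treeOf, mem_neighborSet, fromRel_adj, treeRel, false_or, Sym2.mem_iff,
      Set.mem_insert_iff, Set.mem_singleton_iff, TreeVertex.old.injEq]
    constructor
    · rintro ⟨-, hv, h1 | h1⟩
      · exact Or.inl (congrArg Subtype.val h1)
      · exact Or.inr (congrArg Subtype.val h1)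
    · rintro (rfl | rfl)
      · exact ⟨by simp, x.2, Or.inl rfl⟩
      · exact ⟨by simp, y.2, Or.inr rfl⟩
  · simp [treeOf, treeRel]
  · simp [treeOf, treeRel]

theorem ncard_neighborSet_treeOf_mid (e : ↥(core R).edgeSet) :
    ((treeOf k R).neighborSet (.mid e)).ncard = 2 := by
  obtain ⟨e, he⟩ := e
  induction e using Sym2.ind with
  | _ x y =>
    refine (congrArg Set.ncard (neighborSet_treeOf_mid he)).trans (Set.ncard_pair fun hxy => ?_)
    injection hxy with hxy
    exact (show (core R).Adj x y from he).ne (Subtype.ext hxy)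

theorem neighborSet_treeOf_pendant (x : ↥(leaves R)ᶜ) (i : Fin (pendantCount k R x)) :
    (treeOf k R).neighborSet (.pendant x i) = {.old x.1} := by
  ext (v | e | ⟨z, j⟩) <;> simp [treeOf, treeRel]

theorem neighborSet_treeOf_leaf {v : W} (hv : v ∈ leaves R) :
    (treeOf k R).neighborSet (.old v) = TreeVertex.old '' R.neighborSet v := by
  ext (w | e | ⟨z, j⟩)
  · simp only [treeOf, mem_neighborSet, fromRel_adj, treeRel, hv, true_or, and_true, or_true,
      Set.mem_image, TreeVertex.old.injEq, exists_eq_right, ne_eq]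
    rw [R.adj_comm w v, or_self, and_iff_right_of_imp]
    exact fun h => h.ne
  · simp [treeOf, treeRel, hv]
  · simp only [treeOf, mem_neighborSet, fromRel_adj, treeRel, or_false, Set.mem_image, reduceCtorEq,
      and_false, exists_false, iff_false, not_and]
    rintro - rfl
    exact z.2 hv

theorem neighborSet_treeOf_core (x : ↥(leaves R)ᶜ) :
    (treeOf k R).neighborSet (.old x.1) =
      (TreeVertex.old '' {y | y ∈ leaves R ∧ R.Adj x y} ∪ Set.range (TreeVertex.pendant x)) ∪
        TreeVertex.mid '' {e | x ∈ (e : Sym2 ↥(leaves R)ᶜ)} := by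
  have hx := x.2
  rw [Set.mem_compl_iff] at hx
  ext (w | e | ⟨z, j⟩)
  · simp only [treeOf, mem_neighborSet, fromRel_adj, treeRel, hx, false_or, or_false, Set.mem_union,
      Set.mem_image, TreeVertex.old.injEq, exists_eq_right, ne_eq, Set.mem_ofPred_eq, Set.mem_range,
      reduceCtorEq, and_false, exists_false]
    rw [R.adj_comm w x, or_self, and_iff_right_of_imp, and_comm]
    exact fun h => h.1.ne
  · simp only [treeOf, mem_neighborSet, fromRel_adj, treeRel, or_false, Set.mem_union,
      Set.mem_image, Set.mem_range, reduceCtorEq, and_false, exists_false, false_or, ne_eq,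
      not_false_eq_true, true_and, TreeVertex.mid.injEq, exists_eq_right, Set.mem_ofPred_eq]
    exact ⟨fun ⟨_, h⟩ => h, fun h => ⟨x.2, h⟩⟩
  · simp only [treeOf, mem_neighborSet, fromRel_adj, treeRel, or_false, Set.mem_union,
      Set.mem_image, Set.mem_range, reduceCtorEq, and_false, exists_false, false_or, ne_eq,
      not_false_eq_true, true_and]
    constructor
    · intro h
      obtain rfl := Subtype.ext h
      exact ⟨j, rfl⟩
    · rintro ⟨i, hi⟩
      injection hi with hi
      rw [hi]

theorem ncard_edges_core (x : ↥(leaves R)ᶜ) :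
    {e : ↥(core R).edgeSet | x ∈ (e : Sym2 ↥(leaves R)ᶜ)}.ncard = coreDegree R x := by
  symm
  refine Set.ncard_congr (fun y hy => ⟨s(x, y), hy⟩) (fun y _ => Sym2.mem_mk_left _ _) ?_ ?_
  · intro y z hy hz hyz
    exact Sym2.congr_right.1 (congrArg Subtype.val hyz)
  · rintro ⟨e, he⟩ hx
    obtain ⟨y, rfl⟩ := Sym2.mem_iff_exists.1 hx
    exact ⟨y, he, rfl⟩

/-- Only the core vertices can have more than two neighbors. If d' = 2r+1, such a vertex gets at
most 1 from each of 2r+1 inserted vertices and at most 2 from each of ℓ + (k-r-ℓ) = k-r leaves,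
altogether at most 2k+1. -/
theorem IsBaseTree.isLight [Finite W] (h : IsBaseTree k R) (hk : 2 ≤ k) (u : TreeVertex k R) :
    IsLight k (treeOf k R) u := by
  have hmid : Function.Injective (TreeVertex.mid : _ → TreeVertex k R) := fun _ _ h => by
    injection h
  have hold : Function.Injective (TreeVertex.old : _ → TreeVertex k R) := fun _ _ h => by
    injection h
  rcases u with v | e | ⟨x, i⟩
  · by_cases hv : v ∈ leaves R
    · have h1 : (R.neighborSet v).ncard = 1 := hv
      refine isLight_of_ncard_le ?_ ?_ <;>
        rw [neighborSet_treeOf_leaf hv, Set.ncard_image_of_injective _ hold, h1]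
      omega
    · obtain ⟨r, hr, hd⟩ := h.coreDegree_odd ⟨v, hv⟩
      have hl := h.leafCount_le ⟨v, hv⟩
      have hn : (treeOf k R).neighborSet (.old v) = _ :=
        neighborSet_treeOf_core (⟨v, hv⟩ : ↥(leaves R)ᶜ)
      have hm : (TreeVertex.mid '' {e : ↥(core R).edgeSet | ⟨v, hv⟩ ∈ (e : Sym2 ↥(leaves R)ᶜ)} :
          Set (TreeVertex k R)).ncard = 2 * r + 1 := by
        rw [Set.ncard_image_of_injective _ hmid, ncard_edges_core, hd]
      constructor
      · have := Set.ncard_le_ncard (hn ▸ Set.subset_union_right) (Set.toFinite _)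
        rw [hm] at this
        omega
      · refine (weight_le _ _ hn.subset ?_ ?_).trans ?_
        · rw [Set.disjoint_left]
          rintro _ (⟨y, -, rfl⟩ | ⟨i, rfl⟩) ⟨e, -, he⟩ <;> cases he
        · rintro _ ⟨e, -, rfl⟩
          exact (ncard_neighborSet_treeOf_mid e).ge
        · rw [hm]
          have h1 : (TreeVertex.old '' {y | y ∈ leaves R ∧ R.Adj v y} ∪
              Set.range (TreeVertex.pendant (k := k) (⟨v, hv⟩ : ↥(leaves R)ᶜ))).ncard ≤ k - r := by
            refine (Set.ncard_union_le _ _).trans ?_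
            rw [Set.ncard_image_of_injective _ hold, ← Set.image_univ]
            have h2 := Set.ncard_image_le (f := TreeVertex.pendant (k := k)
              (⟨v, hv⟩ : ↥(leaves R)ᶜ)) (Set.toFinite Set.univ)
            rw [Set.ncard_univ, Nat.card_fin] at h2
            refine (Nat.add_le_add_left h2 _).trans ?_
            have h3 : {y | y ∈ leaves R ∧ R.Adj v y}.ncard = leafCount R ⟨v, hv⟩ := rfl
            rw [h3]
            unfold pendantCount
            omega
          have h4 : 2 * (k - r) + (2 * r + 1) = 2 * k + 1 := by omega
          have h5 : (2 : ℚ) * (k - r : ℕ) + (2 * r + 1 : ℕ) = 2 * k + 1 := by exact_mod_cast h4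
          rw [← h5]
          have h6 := (Nat.cast_le (α := ℚ)).2 h1
          linarith
  · refine isLight_of_ncard_le ?_ ?_ <;> rw [ncard_neighborSet_treeOf_mid] <;> omega
  · refine isLight_of_ncard_le ?_ ?_ <;> rw [neighborSet_treeOf_pendant, Set.ncard_singleton]
    omega

end TreeOf

theorem IsSpecialTree.isLight {C : Type*} {k : ℕ} {T : SimpleGraph C} (hk : 2 ≤ k)
    (h : IsSpecialTree k T) (u : C) : IsLight k T u := by
  obtain ⟨m, R, hR, ⟨e⟩⟩ := h
  exact IsLight.of_iso e (hR.isLight hk) u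

theorem isLight_of_components {V : Type*} {k : ℕ} (hk : 2 ≤ k) {H : SimpleGraph V}
    (h : ∀ c : H.ConnectedComponent,
      IsSmallStar k c.toSimpleGraph ∨ IsSpecialTree k c.toSimpleGraph) (v : V) :
    IsLight k H v := by
  set c := H.connectedComponentMk v with hc
  have hl : ∀ u, IsLight k c.toSimpleGraph u := (h c).elim IsSmallStar.isLight
    (IsSpecialTree.isLight hk)
  refine (hl ⟨v, rfl⟩).map (φ := Subtype.val) Subtype.val_injective fun u => ?_
  ext w
  constructor
  · intro hw
    refine ⟨⟨w, ?_⟩, hw, rfl⟩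
    have hu : H.connectedComponentMk u = c := u.2
    change H.connectedComponentMk w = c
    rw [← hu]
    exact (ConnectedComponent.connectedComponentMk_eq_of_adj hw).symm
  · rintro ⟨w, hw, rfl⟩
    exact hw

/-- Double counting: since no vertex is isolated, `s` sends out weight 2|s| in full; all of it lands
in `sᶜ`, where each vertex receives at most 2k+1. -/
theorem two_mul_card_le_of_isLight {V : Type*} [Fintype V] [DecidableEq V] {k : ℕ}
    {H : SimpleGraph V} (h : ∀ v, IsLight k H v) {s : Finset V} (hs : H.IsIndepSet s) :
    2 * s.card ≤ (2 * k + 1) * sᶜ.card := by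
  classical
  have hsum : ∀ u, ∑ v with H.Adj u v, (2 : ℚ) / (H.neighborSet u).ncard = 2 := fun u => by
    have h1 : (H.neighborSet u).ncard = (Finset.univ.filter fun v => H.Adj u v).card := by
      rw [← Set.ncard_coe_finset]
      congr 1
      ext v
      simp
    have h2 : ((H.neighborSet u).ncard : ℚ) ≠ 0 := by
      have := (h u).1
      exact_mod_cast (by omega : (H.neighborSet u).ncard ≠ 0)
    rw [Finset.sum_const, ← h1, nsmul_eq_mul, mul_div_cancel₀ _ h2]
  have hw : ∀ v, ∑ u with H.Adj v u, (2 : ℚ) / (H.neighborSet u).ncard ≤ 2 * k + 1 := fun v => by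
    have h1 := (h v).2
    unfold weight at h1
    rw [finsum_mem_eq_toFinset_sum] at h1
    convert h1 using 2
    ext u
    simp
  have key : (2 : ℚ) * s.card ≤ (2 * k + 1) * sᶜ.card := by
    calc (2 : ℚ) * s.card = ∑ u ∈ s, ∑ v with H.Adj u v, (2 : ℚ) / (H.neighborSet u).ncard := by
          rw [Finset.sum_congr rfl fun u _ => hsum u, Finset.sum_const, nsmul_eq_mul, mul_comm]
      _ = ∑ u ∈ s, ∑ v ∈ sᶜ with H.Adj u v, (2 : ℚ) / (H.neighborSet u).ncard := by
          refine Finset.sum_congr rfl fun u hu => Finset.sum_congr ?_ fun _ _ => rfl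
          ext v
          simp only [Finset.mem_filter, Finset.mem_univ, true_and, Finset.mem_compl]
          exact ⟨fun huv => ⟨fun hv => hs hu hv huv.ne huv, huv⟩, fun huv => huv.2⟩
      _ = ∑ v ∈ sᶜ, ∑ u ∈ s with H.Adj v u, (2 : ℚ) / (H.neighborSet u).ncard := by
          simp only [Finset.sum_filter]
          rw [Finset.sum_comm]
          simp only [H.adj_comm]
      _ ≤ ∑ v ∈ sᶜ, (2 * k + 1 : ℚ) := by
          refine Finset.sum_le_sum fun v _ => (Finset.sum_le_sum_of_subset_of_nonneg ?_
            fun _ _ _ => by positivity).trans (hw v)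
          exact Finset.filter_subset_filter _ (Finset.subset_univ s)
      _ = (2 * k + 1) * sᶜ.card := by rw [Finset.sum_const, nsmul_eq_mul, mul_comm]
  exact_mod_cast key

end Weight

/-! ### The extremal graphs, and the proof of (ii). -/

section Extremal

variable (k t : ℕ)

theorem extremalGraph_adj_inl_inl (a b : Fin (2 + 2 * t)) :
    (extremalGraph k t).Adj (.inl a) (.inl b) ↔ a ≠ b := by
  simp [extremalGraph, join]

theorem extremalGraph_adj_inl_inr (a : Fin (2 + 2 * t)) (b : Fin ((1 + t) * (2 * k + 1) + 1)) :
    (extremalGraph k t).Adj (.inl a) (.inr b) := by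
  simp [extremalGraph, join]

theorem extremalGraph_not_adj_inr_inr (a b : Fin ((1 + t) * (2 * k + 1) + 1)) :
    ¬ (extremalGraph k t).Adj (.inr a) (.inr b) := by
  simp [extremalGraph, join]

theorem ncard_range_inl :
    (Set.range (.inl : _ → Fin (2 + 2 * t) ⊕ Fin ((1 + t) * (2 * k + 1) + 1))).ncard =
      2 + 2 * t := by
  rw [← Set.image_univ, Set.ncard_image_of_injective _ Sum.inl_injective, Set.ncard_univ,
    Nat.card_fin]

theorem ncard_range_inr :
    (Set.range (.inr : _ → Fin (2 + 2 * t) ⊕ Fin ((1 + t) * (2 * k + 1) + 1))).ncard =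
      (1 + t) * (2 * k + 1) + 1 := by
  rw [← Set.image_univ, Set.ncard_image_of_injective _ Sum.inr_injective, Set.ncard_univ,
    Nat.card_fin]

theorem minDegree_extremalGraph (hk : 1 ≤ k) [DecidableRel (extremalGraph k t).Adj] :
    (extremalGraph k t).minDegree = 2 + 2 * t := by
  have hdeg : ∀ v, (extremalGraph k t).degree v = ((extremalGraph k t).neighborSet v).ncard :=
    fun v => by rw [Set.ncard_eq_toFinset_card', ← card_neighborFinset_eq_degree]; rfl
  have hinr : ∀ b, (extremalGraph k t).neighborSet (.inr b) = Set.range .inl := fun b => by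
    ext (a | a)
    · simpa using (extremalGraph_adj_inl_inr k t a b).symm
    · simpa using extremalGraph_not_adj_inr_inr k t b a
  refine le_antisymm ?_ (le_minDegree_of_forall_le_degree _ _ ?_)
  · refine (minDegree_le_degree _ (.inr 0)).trans ?_
    rw [hdeg, hinr, ncard_range_inl]
  · rintro (a | b)
    · rw [hdeg]
      have h1 : Set.range .inr ⊆ (extremalGraph k t).neighborSet (.inl a) := by
        rintro _ ⟨b, rfl⟩
        exact extremalGraph_adj_inl_inr k t a b
      have h2 := Set.ncard_le_ncard h1 (Set.toFinite _)
      rw [ncard_range_inr] at h2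
      nlinarith
    · rw [hdeg, hinr, ncard_range_inl]

theorem isIndepSet_range_inr :
    (extremalGraph k t).IsIndepSet ↑(Finset.univ.map (.inr :
      Fin ((1 + t) * (2 * k + 1) + 1) ↪ Fin (2 + 2 * t) ⊕ Fin ((1 + t) * (2 * k + 1) + 1))) := by
  intro u hu v hv _
  obtain ⟨a, -, rfl⟩ := Finset.mem_map.1 (Finset.mem_coe.1 hu)
  obtain ⟨b, -, rfl⟩ := Finset.mem_map.1 (Finset.mem_coe.1 hv)
  exact extremalGraph_not_adj_inr_inr k t a b

theorem indepNum_extremalGraph :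
    (extremalGraph k t).indepNum = (1 + t) * (2 * k + 1) + 1 := by
  refine le_antisymm ?_ ?_
  · obtain ⟨s, hs, hcard⟩ := (extremalGraph k t).exists_isNIndepSet_indepNum
    rw [← hcard]
    -- A vertex of the clique is adjacent to all other vertices, so an independent set containing it
    -- is a singleton.
    by_cases h : ∃ a, .inl a ∈ s
    · obtain ⟨a, ha⟩ := h
      have : s ⊆ {.inl a} := by
        intro v hv
        rw [Finset.mem_singleton]
        by_contra hne
        refine hs ha hv (Ne.symm hne) ?_
        rcases v with b | b
        · rw [extremalGraph_adj_inl_inl]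
          rintro rfl
          exact hne rfl
        · exact extremalGraph_adj_inl_inr k t a b
      have := Finset.card_le_card this
      rw [Finset.card_singleton] at this
      omega
    · push Not at h
      have : s ⊆ Finset.univ.map .inr := by
        rintro (a | b) hv
        · exact absurd hv (h a)
        · simp
      simpa using Finset.card_le_card this
  · simpa using (isIndepSet_range_inr k t).card_le_indepNum

theorem not_hasStarTreeFactor_extremalGraph (hk : 2 ≤ k) :
    ¬ HasStarTreeFactor k (extremalGraph k t) := by
  rintro ⟨H, hH, hc⟩
  have h := two_mul_card_le_of_isLight (isLight_of_components hk hc)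
    (s := Finset.univ.map .inr) fun u hu v hv hne huv =>
      isIndepSet_range_inr k t hu hv hne (hH huv)
  rw [Finset.card_compl] at h
  simp only [Finset.card_map, Finset.card_univ, Fintype.card_fin, Fintype.card_sum,
    Nat.add_sub_cancel] at h
  -- The inequality `h` fails by two: 2((1+t)(2k+1)+1) against (2k+1)(2+2t).
  nlinarith

end Extremal

end ComponentFactor

theorem theorem1p5 (k : ℕ) (hk : 2 ≤ k) :
    (∀ (V : Type*) [Fintype V] (G : SimpleGraph V) [DecidableRel G.Adj],
      (2 * (G.indepNum : ℝ)) / (2 * (k : ℝ) + 1) ≤ (G.minDegree : ℝ) →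
        ComponentFactor.HasStarTreeFactor k G) ∧
    (∀ (t : ℕ) [DecidableRel (ComponentFactor.extremalGraph k t).Adj],
      (ComponentFactor.extremalGraph k t).minDegree = 2 + 2 * t ∧
      (ComponentFactor.extremalGraph k t).indepNum = (1 + t) * (2 * k + 1) + 1 ∧
      ((ComponentFactor.extremalGraph k t).minDegree : ℝ) =
        (((ComponentFactor.extremalGraph k t).indepNum : ℝ) - 1) / ((k : ℝ) + 1 / 2) ∧
      ¬ ComponentFactor.HasStarTreeFactor k (ComponentFactor.extremalGraph k t)) := by
  refine ⟨fun V _ G _ h => ComponentFactor.hasStarTreeFactor_of_le_minDegree hk h, fun t _ => ?_⟩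
  have h1 := ComponentFactor.minDegree_extremalGraph k t (by omega)
  have h2 := ComponentFactor.indepNum_extremalGraph k t
  refine ⟨h1, h2, ?_, ComponentFactor.not_hasStarTreeFactor_extremalGraph k t hk⟩
  rw [h1, h2, eq_div_iff (by positivity)]
  push_cast
  ring
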